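/- Let $0<\mu<L$ and $\kappa=L/\mu$. Let $f(x)=\frac12 x^TQx+p^Tx+r$ on $\mathbb R^d$, where $Q=U\Lambda U^T$ is symmetric, $U$ is orthogonal and $\Lambda=\mathrm{diag}(\lambda_1,\dots,\lambda_d)$ with smallest eigenvalue $\min_i\lambda_i=\mu$ and largest eigenvalue $\max_i\lambda_i=L$; let $x_*$ be the minimizer of $f$. For parameters $(\alpha,\beta,\nu)$ consider the momentum method with gradient errors $w_k$, $$x_{k+1}=x_k-\alpha\big(\nabla f(y_k)+w_k\big)+\beta(x_k-x_{k-1}),\qquad y_k=x_k+\nu(x_k-x_{k-1}),$$ with state $\xi_k=(x_k,x_{k-1})$, $\xi_*=(x_*,x_*)$, and put $$A_Q=\begin{bmatrix}(1+\beta)I-\alpha(1+\nu)Q & -\beta I+\alpha\nu Q\\ I&0\end{bmatrix},\quad B=\begin{bmatrix}-\alpha I\\0\end{bmatrix},\quad T=\Big[\tfrac1{\sqrt2}\Lambda^{1/2}U^T\;\;0\Big],\quad G(z)=T(zI-A_Q)^{-1}B .$$ With $\|\cdot\|$ the spectral norm of matrices and $\rho(\cdot)$ the spectral radius, let $H_\infty=\max_{|z|=1}\|G(z)\|$;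 for $\mathbb K\in\{\mathbb R,\mathbb C\}$ let $$r_{\mathbb K}(A_Q,B,T)=\inf\Big\{\varepsilon>0:\ \max_{\Delta\in\mathbb K^{d\times d},\,\|\Delta\|\le\varepsilon}\rho(A_Q+B\Delta T)\ge1\Big\}$$ (the real and complex stability radii); and let the $\ell_2$ gain $L_{2,*}$ be the infimum of all $\gamma\ge0$ for which there is $H:\mathbb R^{2d}\to[0,\infty)$ with $H(\xi_*)=0$ such that for all $\xi_0\in\mathbb R^{2d}$ and all square-summable $(w_k)_{k\ge0}$ in $\mathbb R^d$ $$\sum_{k\ge0}\big(f(x_k)-f(x_*)\big)\le\gamma^2\sum_{k\ge0}\|w_k\|^2+H(\xi_0).$$ Suppose that $(\alpha,\beta,\nu)$ is one of the following: 1. GD: $\alpha=\frac1L$, $\beta=\nu=0$; 2. GD: $\alpha=\frac2{L+\mu}$, $\beta=\nu=0$; 3. RS-GD: $\alpha=\frac2{L+\sqrt{L\mu}}$, $\beta=\nu=0$; 4. NAG: $\alpha=\frac1L$, $\beta=\nu=\frac{1-1/\sqrt\kappa}{1+1/\sqrt\kappa}$; 5. NAG: $\alpha=\frac4{3L+\mu}$,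 $\beta=\nu=\frac{\sqrt{3\kappa+1}-2}{\sqrt{3\kappa+1}+2}$; 6. NAG: any $\alpha\in(0,\frac1L]$, $\beta=\nu=\frac{1-\sqrt{\alpha\mu}}{1+\sqrt{\alpha\mu}}$; 7. TMM: $\alpha=\frac{1+\rho}L$, $\beta=\frac{\rho^2}{2-\rho}$, $\nu=\frac{\rho^2}{(1+\rho)(2-\rho)}$ with $\rho=1-\frac1{\sqrt\kappa}$; 8. HB: $\alpha=\frac4{(\sqrt L+\sqrt\mu)^2}$, $\beta=\big(\frac{\sqrt\kappa-1}{\sqrt\kappa+1}\big)^2$, $\nu=0$; 9. RS-HB: $\alpha=\frac{a(\kappa)^2}L$, $\beta=\big(1-\frac{a(\kappa)}{\sqrt\kappa}\big)^2$, $\nu=0$, where $a(\kappa)=\frac{\sqrt\kappa(\sqrt{2\kappa-1}-1)}{\kappa-1}$ if $\kappa\ge32$ and $a(\kappa)=1$ otherwise. Then $\rho(A_Q)<1$, $0<H_\infty<\infty$, and $$r_{\mathbb R}(A_Q,B,T)=r_{\mathbb C}(A_Q,B,T)=\frac1{H_\infty}=\frac1{L_{2,*}} .$$ -/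

import Mathlib

open Matrix
open scoped NNReal ENNReal Matrix.Norms.L2Operator

noncomputable section

namespace GMM

/-- The quadratic objective `f(x) = (1/2) xᵀ Q x + pᵀ x + r` on Euclidean space. -/
def quadObj {d : ℕ} (Q : Matrix (Fin d) (Fin d) ℝ) (p : EuclideanSpace ℝ (Fin d)) (r : ℝ)
    (x : EuclideanSpace ℝ (Fin d)) : ℝ :=
  1 / 2 * (x.ofLp ⬝ᵥ Q *ᵥ x.ofLp) + p.ofLp ⬝ᵥ x.ofLp + r

/-- The states `ξ_k = (x_k, x_{k-1})` of the generalized momentum method with inexact gradients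
`∇f(y_k) + w_k`, started from `ξ₀ = (x_0, x_{-1})`. -/
def state {d : ℕ} (f : EuclideanSpace ℝ (Fin d) → ℝ) (α β ν : ℝ)
    (w : ℕ → EuclideanSpace ℝ (Fin d))
    (ξ₀ : EuclideanSpace ℝ (Fin d) × EuclideanSpace ℝ (Fin d)) :
    ℕ → EuclideanSpace ℝ (Fin d) × EuclideanSpace ℝ (Fin d)
  | 0 => ξ₀
  | k + 1 =>
    let x := (state f α β ν w ξ₀ k).1
    let xprev := (state f α β ν w ξ₀ k).2
    let y := x + ν • (x - xprev)
    (x - α • (gradient f y + w k) + β • (x - xprev), x)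

/-- The noisy system, with output `z_k` such that `‖z_k‖² = f(x_k) - f(x_*)`, has
`ℓ₂` gain at most `γ`. -/
def HasGainLE {d : ℕ} (f : EuclideanSpace ℝ (Fin d) → ℝ) (xstar : EuclideanSpace ℝ (Fin d))
    (α β ν : ℝ) (γ : ℝ≥0) : Prop :=
  ∃ H : EuclideanSpace ℝ (Fin d) × EuclideanSpace ℝ (Fin d) → ℝ≥0,
    H (xstar, xstar) = 0 ∧
    ∀ (ξ₀ : EuclideanSpace ℝ (Fin d) × EuclideanSpace ℝ (Fin d))
      (w : ℕ → EuclideanSpace ℝ (Fin d)), Summable (fun k => ‖w k‖ ^ 2) →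
      Summable (fun k => f (state f α β ν w ξ₀ k).1 - f xstar) ∧
      ∑' k, (f (state f α β ν w ξ₀ k).1 - f xstar)
        ≤ (γ : ℝ) ^ 2 * ∑' k, ‖w k‖ ^ 2 + H ξ₀

/-- The `ℓ₂` gain `L_{2,*}`: the infimum of the gain bounds, and `∞` if there is none. -/
def l2Gain {d : ℕ} (f : EuclideanSpace ℝ (Fin d) → ℝ) (xstar : EuclideanSpace ℝ (Fin d))
    (α β ν : ℝ) : ℝ≥0∞ :=
  ⨅ (γ : ℝ≥0) (_ : HasGainLE f xstar α β ν γ), (γ : ℝ≥0∞)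

/-- The iteration matrix `A_Q`. -/
def AQ {d : ℕ} (Q : Matrix (Fin d) (Fin d) ℝ) (α β ν : ℝ) :
    Matrix (Fin d ⊕ Fin d) (Fin d ⊕ Fin d) ℝ :=
  fromBlocks ((1 + β) • 1 - (α * (1 + ν)) • Q) (-β • 1 + (α * ν) • Q) 1 0

/-- The input matrix `B = [-α I ; 0]`. -/
def Bmat (d : ℕ) (α : ℝ) : Matrix (Fin d ⊕ Fin d) (Fin d) ℝ :=
  fromRows (-α • 1) 0

/-- The output matrix `T = [2^{-1/2} Λ^{1/2} Uᵀ , 0]`, where `Λ` is the diagonal matrix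
of the entries of `lam`. -/
def Tmat {d : ℕ} (U : Matrix (Fin d) (Fin d) ℝ) (lam : Fin d → ℝ) :
    Matrix (Fin d) (Fin d ⊕ Fin d) ℝ :=
  fromCols ((1 / √2) • (diagonal (fun i => √(lam i)) * Uᵀ)) 0

/-- Entrywise complexification of a real matrix. -/
abbrev toC {m n : Type*} (M : Matrix m n ℝ) : Matrix m n ℂ := M.map Complex.ofReal

section LinearSystem

variable {d : ℕ} (A : Matrix (Fin d ⊕ Fin d) (Fin d ⊕ Fin d) ℝ)
  (B : Matrix (Fin d ⊕ Fin d) (Fin d) ℝ) (T : Matrix (Fin d) (Fin d ⊕ Fin d) ℝ)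

/-- The transfer matrix `G(z) = T (zI - A)⁻¹ B`. -/
def transfer (z : ℂ) : Matrix (Fin d) (Fin d) ℂ :=
  toC T * (z • (1 : Matrix (Fin d ⊕ Fin d) (Fin d ⊕ Fin d) ℂ) - toC A)⁻¹ * toC B

/-- The `H_∞` norm: the supremum over the unit circle of the spectral norm of `G(z)`. -/
def hInf : ℝ≥0∞ :=
  ⨆ (z : ℂ) (_ : ‖z‖ = 1), ‖transfer A B T z‖ₑ

/-- The worst spectral radius over complex perturbations of spectral norm at most `ε`. -/
def rhoC (ε : ℝ≥0) : ℝ≥0∞ :=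
  ⨆ (Δ : Matrix (Fin d) (Fin d) ℂ) (_ : ‖Δ‖ ≤ ε), spectralRadius ℂ (toC A + toC B * Δ * toC T)

/-- The worst spectral radius over real perturbations of spectral norm at most `ε`. -/
def rhoR (ε : ℝ≥0) : ℝ≥0∞ :=
  ⨆ (Δ : Matrix (Fin d) (Fin d) ℝ) (_ : ‖Δ‖ ≤ ε), spectralRadius ℂ (toC (A + B * Δ * T))

/-- The complex stability radius (`∞` if no perturbation destabilizes the system). -/
def stabRadiusC : ℝ≥0∞ :=
  ⨅ (ε : ℝ≥0) (_ : 0 < ε ∧ 1 ≤ rhoC A B T ε), (ε : ℝ≥0∞)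

/-- The real stability radius (`∞` if no real perturbation destabilizes the system). -/
def stabRadiusR : ℝ≥0∞ :=
  ⨅ (ε : ℝ≥0) (_ : 0 < ε ∧ 1 ≤ rhoR A B T ε), (ε : ℝ≥0∞)

end LinearSystem

/-- The coefficient `a(κ)` of the robustly stable heavy-ball method. -/
def rshbCoeff (κ : ℝ) : ℝ :=
  if 32 ≤ κ then √κ * (√(2 * κ - 1) - 1) / (κ - 1) else 1

/-- The listed algorithms, as parameter triples `(α, β, ν)`; here `κ = L / μ`. -/
inductive IsListed (μ L : ℝ) : ℝ → ℝ → ℝ → Prop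
  | gdPopular : IsListed μ L (1 / L) 0 0
  | gdFastest : IsListed μ L (2 / (L + μ)) 0 0
  | rsGD : IsListed μ L (2 / (L + √(L * μ))) 0 0
  | nagPopular (β : ℝ) (hβ : β = (1 - 1 / √(L / μ)) / (1 + 1 / √(L / μ))) :
      IsListed μ L (1 / L) β β
  | nagFastest (β : ℝ) (hβ : β = (√(3 * (L / μ) + 1) - 2) / (√(3 * (L / μ) + 1) + 2)) :
      IsListed μ L (4 / (3 * L + μ)) β β
  | nagFamily (α β : ℝ) (hα : 0 < α) (hαL : α ≤ 1 / L)
      (hβ : β = (1 - √(α * μ)) / (1 + √(α * μ))) : IsListed μ L α β β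
  | tmm (ρ : ℝ) (hρ : ρ = 1 - 1 / √(L / μ)) :
      IsListed μ L ((1 + ρ) / L) (ρ ^ 2 / (2 - ρ)) (ρ ^ 2 / ((1 + ρ) * (2 - ρ)))
  | hb : IsListed μ L (4 / (√L + √μ) ^ 2) (((√(L / μ) - 1) / (√(L / μ) + 1)) ^ 2) 0
  | rsHB : IsListed μ L (rshbCoeff (L / μ) ^ 2 / L)
      ((1 - rshbCoeff (L / μ) / √(L / μ)) ^ 2) 0

end GMM

end

/-! ### Positivity certificates for the scalar modes, method by method. -/

namespace GMM

/-! In the eigenbasis of `Q` the system decouples into scalar modes. The mode with eigenvalue λ has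
characteristic polynomial χ(z) = z² - a z + b, and on |z| = 1, up to a unitary factor, G(z) is
diagonal with entries of modulus α√λ / (√2 |χ(z)|). Hence the H∞ norm is α / √(2M), where M is the
minimum of |χ(z)|² / λ over the modes and the circle.

A priori the real stability radius could exceed the complex one. They agree because, for every
listed method, M is attained at a real point z = ±1 and at an extreme eigenvalue (`ExtremalAtReal`).
A real multiple of U then moves an eigenvalue to z (`one_le_rhoR`), and the real noise z^k in that
mode resonates with the largest possible amplitude (`le_of_hasGainLE`).

The bound |χ|² ≥ m, with m = λM, is certified as follows. For z = exp(iθ), p = (1 + cos θ)/2 and q =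
1 - p, one has |χ|² = χ(1)² p + χ(-1)² q - 16 b p q, while A² p + B² q - (A + B)² p q = (A p - B
q)². So it suffices to find A, B with A² + m ≤ χ(1)², B² + m ≤ χ(-1)² and 16 b ≤ (A + B)². Read with
shifts in place of z, the same squares give a storage function, hence the upper bound on the ℓ₂ gain
(`exists_storage`). Schur stability carries the bound to |z| ≥ 1, which bounds the complex radius
below (`two_mul_le_of_mem_spectrum`). -/

/-- The real polynomial `z² - a z + b` is Schur stable, with a sum-of-squares certificate for
`m ≤ |z² - a z + b|²` on the unit circle. -/
structure StableWithMargin (a b m : ℝ) : Prop where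
  pos_one : 0 < 1 - a + b
  pos_neg_one : 0 < 1 + a + b
  lt_one : b < 1
  certificate : ∃ A B : ℝ, A ^ 2 + m ≤ (1 - a + b) ^ 2 ∧ B ^ 2 + m ≤ (1 + a + b) ^ 2 ∧
    16 * b ≤ (A + B) ^ 2

/-- Minus the linear coefficient of the characteristic polynomial of the mode with eigenvalue
`l`. -/
def modeA (α β ν l : ℝ) : ℝ := 1 + β - α * (1 + ν) * l

/-- The constant coefficient of the characteristic polynomial of the mode with eigenvalue `l`. -/
def modeB (α β ν l : ℝ) : ℝ := β - α * ν * l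

/-- All modes are stable, and `λ / |χ_λ(z)|²` is at most `M⁻¹` on the unit circle, with equality
at a real point and an extreme eigenvalue. -/
def ExtremalAtReal (μ L α β ν M : ℝ) : Prop :=
  0 < α ∧ 0 < M ∧
  (∃ z l : ℝ, (z = 1 ∨ z = -1) ∧ (l = μ ∨ l = L) ∧
    (z ^ 2 - modeA α β ν l * z + modeB α β ν l) ^ 2 = l * M) ∧
  ∀ l, μ ≤ l → l ≤ L → StableWithMargin (modeA α β ν l) (modeB α β ν l) (l * M)

variable {μ L α β ν : ℝ}

/-- Since χ(1) = α l, equality at z = 1, l = μ forces M = α² μ, and the positivity of χ(1) is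
automatic. -/
lemma extremalAtReal_of_one (hμ : 0 < μ) (hα : 0 < α)
    (h : ∀ l, μ ≤ l → l ≤ L → 0 < 2 * (1 + β) - α * (1 + 2 * ν) * l ∧ β - α * ν * l < 1 ∧
      ∃ A B : ℝ, A ^ 2 + α * l * (α * μ) ≤ (α * l) ^ 2 ∧
        B ^ 2 + α * l * (α * μ) ≤ (2 * (1 + β) - α * (1 + 2 * ν) * l) ^ 2 ∧
        16 * (β - α * ν * l) ≤ (A + B) ^ 2) :
    ExtremalAtReal μ L α β ν (α ^ 2 * μ) := by
  refine ⟨hα, by positivity, ⟨1, μ, Or.inl rfl, Or.inl rfl, ?_⟩, fun l h1 h2 => ?_⟩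
  · unfold modeA modeB; ring
  · obtain ⟨hm, hb, A, B, hA, hB, hAB⟩ := h l h1 h2
    have e1 : 1 - modeA α β ν l + modeB α β ν l = α * l := by unfold modeA modeB; ring
    have e2 : 1 + modeA α β ν l + modeB α β ν l = 2 * (1 + β) - α * (1 + 2 * ν) * l := by
      unfold modeA modeB; ring
    have hl : 0 < l := hμ.trans_le h1
    refine ⟨by rw [e1]; positivity, by rwa [e2], hb, A, B, ?_, ?_, hAB⟩
    · rw [e1]; linarith
    · rw [e2]; linarith

/-- Here δ is χ(-1) for the eigenvalue L, so equality at z = -1, l = L forces M = δ² / L. -/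
lemma extremalAtReal_of_neg_one (hμ : 0 < μ) (hμL : μ ≤ L) (hα : 0 < α) {δ : ℝ} (hδ : 0 < δ)
    (hL : 2 * (1 + β) - α * (1 + 2 * ν) * L = δ)
    (h : ∀ l, μ ≤ l → l ≤ L → 0 < 2 * (1 + β) - α * (1 + 2 * ν) * l ∧ β - α * ν * l < 1 ∧
      ∃ A B : ℝ, A ^ 2 + l / L * δ ^ 2 ≤ (α * l) ^ 2 ∧
        B ^ 2 + l / L * δ ^ 2 ≤ (2 * (1 + β) - α * (1 + 2 * ν) * l) ^ 2 ∧
        16 * (β - α * ν * l) ≤ (A + B) ^ 2) :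
    ExtremalAtReal μ L α β ν (δ ^ 2 / L) := by
  have hL0 : 0 < L := hμ.trans_le hμL
  refine ⟨hα, by positivity, ⟨-1, L, Or.inr rfl, Or.inr rfl, ?_⟩, fun l h1 h2 => ?_⟩
  · rw [← hL]; unfold modeA modeB; field_simp; ring
  · obtain ⟨hm, hb, A, B, hA, hB, hAB⟩ := h l h1 h2
    have e1 : 1 - modeA α β ν l + modeB α β ν l = α * l := by unfold modeA modeB; ring
    have e2 : 1 + modeA α β ν l + modeB α β ν l = 2 * (1 + β) - α * (1 + 2 * ν) * l := by
      unfold modeA modeB; ring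
    have hl : 0 < l := hμ.trans_le h1
    have e3 : l * (δ ^ 2 / L) = l / L * δ ^ 2 := by ring
    refine ⟨by rw [e1]; positivity, by rwa [e2], hb, A, B, ?_, ?_, hAB⟩
    · rw [e1, e3]; exact hA
    · rw [e2, e3]; exact hB

/-- Gradient descent, when the transfer function peaks at `z = 1`. -/
lemma extremalAtReal_gd_one (hμ : 0 < μ) (hα : 0 < α) (h : α * L < 2)
    (h2 : α * L * (α * μ) ≤ (2 - α * L) ^ 2) : ExtremalAtReal μ L α 0 0 (α ^ 2 * μ) := by
  refine extremalAtReal_of_one hμ hα fun l h1 hl => ?_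
  have hlL : α * l ≤ α * L := by gcongr
  have hml : α * μ ≤ α * l := by gcongr
  have hm : 0 < α * μ := by positivity
  -- Without momentum b = 0, so A = B = 0 is admissible and only the values at ±1 matter.
  refine ⟨by linarith, by norm_num, 0, 0, ?_, ?_, by norm_num⟩
  · nlinarith
  · have : α * l * (α * μ) ≤ α * L * (α * μ) := by gcongr
    have : (2 - α * L) ^ 2 ≤ (2 - α * l) ^ 2 := by gcongr
    linarith

lemma extremalAtReal_gdFastest (hμ : 0 < μ) (hμL : μ < L) :
    ∃ M, ExtremalAtReal μ L (2 / (L + μ)) 0 0 M := by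
  have hL : 0 < L := hμ.trans hμL
  set α := 2 / (L + μ) with hα
  have hα0 : 0 < α := by positivity
  have hs : α * L + α * μ = 2 := by rw [hα]; field_simp
  have hm : 0 < α * μ := by positivity
  refine ⟨_, extremalAtReal_of_neg_one (δ := α * μ) hμ hμL.le hα0 hm (by linarith)
    fun l h1 hl => ?_⟩
  have hlL : α * l ≤ α * L := by gcongr
  have hml : α * μ ≤ α * l := by gcongr
  have hq : l / L * (α * μ) ^ 2 ≤ (α * μ) ^ 2 :=
    mul_le_of_le_one_left (by positivity) ((div_le_one hL).2 hl)
  refine ⟨by linarith, by norm_num, 0, 0, ?_, ?_, by norm_num⟩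
  · nlinarith
  · nlinarith

/-- This step size balances the two candidates: χ(-1)² / L at eigenvalue L equals χ(1)² / μ at
eigenvalue μ. -/
lemma extremalAtReal_rsGD (hμ : 0 < μ) (hμL : μ < L) :
    ∃ M, ExtremalAtReal μ L (2 / (L + √(L * μ))) 0 0 M := by
  have hL : 0 < L := hμ.trans hμL
  set α := 2 / (L + √(L * μ)) with hα
  have hr : 0 < √(L * μ) := by positivity
  have hsq : √(L * μ) ^ 2 = L * μ := Real.sq_sqrt (by positivity)
  have hs : α * L + α * √(L * μ) = 2 := by rw [hα]; field_simp
  have hα0 : 0 < α := by positivity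
  have : 0 < α * √(L * μ) := by positivity
  refine ⟨_, extremalAtReal_gd_one hμ hα0 (by linarith) ?_⟩
  have e : 2 - α * L = α * √(L * μ) := by linarith
  rw [e, mul_pow, hsq]; apply le_of_eq; ring

/-- Nesterov's method with `α μ = s²` and `β = ν = (1 - s) / (1 + s)`. -/
lemma extremalAtReal_nag (hμ : 0 < μ) (hα : 0 < α) {s : ℝ} (hs0 : 0 < s)
    (hs1 : s < 1) (hs : α * μ = s ^ 2) (hβ : β = (1 - s) / (1 + s))
    (hαL : α * L ≤ (4 - s ^ 2) / 3) : ExtremalAtReal μ L α β β (α ^ 2 * μ) := by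
  refine extremalAtReal_of_one hμ hα fun l h1 hl => ?_
  have hlL : α * l ≤ α * L := by gcongr
  have hml : α * μ ≤ α * l := by gcongr
  have hβ0 : 0 < β := by rw [hβ]; apply div_pos <;> linarith
  have hβ1 : β * (1 + s) = 1 - s := by rw [hβ]; field_simp
  have hβlt : β < 1 := by nlinarith
  obtain ⟨t, ht⟩ : ∃ t, t = 1 - α * l := ⟨_, rfl⟩
  have el : α * l = 1 - t := by linarith
  have e1 : 2 * (1 + β) - α * (1 + 2 * β) * l = 1 + (1 + 2 * β) * t := by
    linear_combination (-(1 + 2 * β)) * ht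
  have e2 : β - α * β * l = β * t := by linear_combination -β * ht
  rw [e1, e2, el, hs]
  have ht1 : t ≤ 1 - s ^ 2 := by linarith
  have ht2 : -(1 - s ^ 2) / 3 ≤ t := by linarith
  have hk : (1 + 2 * β) * (1 + s) = 3 - s := by linarith
  -- χ(-1) increases with t; the left side is its value at t = -(1 - s²)/3, the end allowed by the
  -- bound on α L.
  have hmin : (4 * s - s ^ 2) / 3 ≤ 1 + (1 + 2 * β) * t := by
    have : (1 + 2 * β) * (-(1 - s ^ 2) / 3) ≤ (1 + 2 * β) * t := by gcongr
    have e : (1 + 2 * β) * (-(1 - s ^ 2) / 3) = -((1 - s) * (3 - s)) / 3 := by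
      linear_combination (-(1 - s) / 3) * hk
    nlinarith
  have hpos : 0 < (4 * s - s ^ 2) / 3 := by nlinarith
  refine ⟨by linarith, by nlinarith, ?_⟩
  rcases le_total t 0 with h0 | h0
  -- For t ≤ 0 the coefficient b = β t is nonpositive, so A = B = 0 suffices.
  · refine ⟨0, 0, by nlinarith, ?_, by nlinarith⟩
    have h3 : ((4 * s - s ^ 2) / 3) ^ 2 ≤ (1 + (1 + 2 * β) * t) ^ 2 := by gcongr
    have h4 : (1 - t) * s ^ 2 ≤ (4 - s ^ 2) / 3 * s ^ 2 := by gcongr; linarith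
    have h5 : (4 - s ^ 2) / 3 * s ^ 2 ≤ ((4 * s - s ^ 2) / 3) ^ 2 := by
      have : 0 ≤ s ^ 2 * (1 - s) ^ 2 := by positivity
      nlinarith
    linarith
  -- With m = s² (1 - t), these are A = χ(1) - m / χ(1) and B = χ(-1) - m.
  · refine ⟨1 - t - s ^ 2, 1 + (1 + 2 * β) * t - s ^ 2 * (1 - t), by nlinarith, ?_, ?_⟩
    · have h6 : 0 ≤ (1 - t) * s ^ 2 := by nlinarith
      have h7 : 0 ≤ (1 + 2 * β) * t := by positivity
      have h8 : 0 ≤ 1 - (1 - t) * s ^ 2 := by nlinarith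
      nlinarith [mul_nonneg h6 h8, mul_nonneg h6 h7]
    · have h9 : 0 < 1 - s ^ 2 := by nlinarith
      -- Normalized so that √b = (1 - s) r; up to the term s² t ≥ 0, the claim 4√b ≤ A + B is then
      -- s² ≤ (1 - √b)².
      obtain ⟨r, hr⟩ : ∃ r, r = √(t / (1 - s ^ 2)) := ⟨_, rfl⟩
      have hr0 : 0 ≤ r := by rw [hr]; positivity
      have hr2 : t = r ^ 2 * (1 - s ^ 2) := by
        rw [hr, Real.sq_sqrt (by positivity)]; field_simp
      have hr1 : r ≤ 1 := by
        rw [hr]; exact Real.sqrt_le_one.2 ((div_le_one h9).2 ht1)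
      have hbt : β * t = ((1 - s) * r) ^ 2 := by
        rw [hr2]; linear_combination (r ^ 2 * (1 - s)) * hβ1
      have e3 : 1 - t - s ^ 2 + (1 + (1 + 2 * β) * t - s ^ 2 * (1 - t))
          = 2 + 2 * (β * t) - 2 * s ^ 2 + s ^ 2 * t := by ring
      have h10 : s ≤ 1 - (1 - s) * r := by
        have : (1 - s) * r ≤ 1 - s := mul_le_of_le_one_right (by linarith) hr1
        linarith
      have h11 : s ^ 2 ≤ (1 - (1 - s) * r) ^ 2 := by gcongr
      have h12 : 4 * ((1 - s) * r) ≤ 2 + 2 * (β * t) - 2 * s ^ 2 + s ^ 2 * t := by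
        have : 0 ≤ s ^ 2 * t := by positivity
        rw [hbt]; linarith
      have h13 : 0 ≤ 4 * ((1 - s) * r) := by
        have : 0 ≤ 1 - s := by linarith
        positivity
      rw [e3]
      calc 16 * (β * t) = (4 * ((1 - s) * r)) ^ 2 := by rw [hbt]; ring
        _ ≤ _ := pow_le_pow_left₀ h13 h12 2

lemma extremalAtReal_tmm (hμ : 0 < μ) (hμL : μ < L) {ρ : ℝ} (h0 : 0 < ρ) (h1 : ρ < 1)
    (hρ : μ = L * (1 - ρ) ^ 2) :
    ∃ M, ExtremalAtReal μ L ((1 + ρ) / L) (ρ ^ 2 / (2 - ρ)) (ρ ^ 2 / ((1 + ρ) * (2 - ρ))) M := by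
  have hL : 0 < L := hμ.trans hμL
  have hd : 0 < 2 - ρ := by linarith
  refine ⟨_, extremalAtReal_of_neg_one (δ := 1 - ρ) hμ hμL.le (by positivity) (by linarith) ?_
    fun l hl1 hl2 => ?_⟩
  · field_simp; ring
  -- In this variable b = ρ² q, and q ranges over [0, ρ] because 1 - (1 - ρ)² = ρ (2 - ρ).
  obtain ⟨q, hq⟩ : ∃ q, q = (1 - l / L) / (2 - ρ) := ⟨_, rfl⟩
  have hlq : l / L = 1 - (2 - ρ) * q := by rw [hq]; field_simp; ring
  have hlq' : l = L * (1 - (2 - ρ) * q) := by rw [← hlq]; field_simp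
  have hx1 : l / L ≤ 1 := (div_le_one hL).2 hl2
  have hx0 : (1 - ρ) ^ 2 ≤ l / L := by rw [le_div_iff₀ hL]; linarith
  have hq0 : 0 ≤ q := by rw [hq]; exact div_nonneg (by linarith) hd.le
  have hqρ : q ≤ ρ := by rw [hq, div_le_iff₀ hd]; nlinarith
  have eb : ρ ^ 2 / (2 - ρ) - (1 + ρ) / L * (ρ ^ 2 / ((1 + ρ) * (2 - ρ))) * l = ρ ^ 2 * q := by
    rw [hlq']; field_simp; ring
  have ep : (1 + ρ) / L * l = (1 + ρ) * (l / L) := by ring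
  have em : 2 * (1 + ρ ^ 2 / (2 - ρ)) - (1 + ρ) / L * (1 + 2 * (ρ ^ 2 / ((1 + ρ) * (2 - ρ)))) * l
      = 1 - ρ + (2 + ρ + ρ ^ 2) * q := by
    rw [hlq']; field_simp; ring
  rw [eb, ep, em]
  generalize l / L = x at *
  have hkq : 0 ≤ (2 + ρ + ρ ^ 2) * q := by positivity
  -- With m = x (1 - ρ)² and δ = 1 - ρ, these are A = χ(1) - m / χ(1) and B = χ(-1) - m / δ.
  refine ⟨by linarith, by nlinarith [mul_pos h0 h0], (1 + ρ) * x - (1 - ρ) ^ 2 / (1 + ρ),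
    1 - ρ + (2 + ρ + ρ ^ 2) * q - (1 - ρ) * x, ?_, ?_, ?_⟩
  · have e : ((1 + ρ) * x) ^ 2 - (((1 + ρ) * x - (1 - ρ) ^ 2 / (1 + ρ)) ^ 2 + x * (1 - ρ) ^ 2)
        = (1 - ρ) ^ 2 * (x - (1 - ρ) ^ 2 / (1 + ρ) ^ 2) := by field_simp; ring
    have : (1 - ρ) ^ 2 / (1 + ρ) ^ 2 ≤ (1 - ρ) ^ 2 :=
      div_le_self (by positivity) (by nlinarith)
    have : 0 ≤ (1 - ρ) ^ 2 * (x - (1 - ρ) ^ 2 / (1 + ρ) ^ 2) :=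
      mul_nonneg (by positivity) (by linarith)
    linarith
  · have hs : 0 < 1 - ρ := by linarith
    have hx : 0 ≤ x := le_trans (by positivity) hx0
    have a1 : 0 ≤ (1 - ρ) * x * ((2 + ρ + ρ ^ 2) * q) := by positivity
    have a2 : 0 ≤ (1 - ρ) ^ 2 * x * (1 - x) := mul_nonneg (by positivity) (by linarith)
    nlinarith
  · obtain ⟨r, hr⟩ : ∃ r, r = √q := ⟨_, rfl⟩
    have hr0 : 0 ≤ r := by rw [hr]; positivity
    have hr2 : q = r ^ 2 := by rw [hr, Real.sq_sqrt hq0]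
    have e : (1 + ρ) * x - (1 - ρ) ^ 2 / (1 + ρ) + (1 - ρ + (2 + ρ + ρ ^ 2) * q - (1 - ρ) * x)
        = 4 * ρ / (1 + ρ) + (3 * ρ ^ 2 - 3 * ρ + 2) * r ^ 2 := by
      rw [hlq, hr2]; field_simp; ring
    have hk : 4 * ρ * r ≤ 4 * ρ / (1 + ρ) + (3 * ρ ^ 2 - 3 * ρ + 2) * r ^ 2 := by
      have e2 : 4 * ρ / (1 + ρ) + (3 * ρ ^ 2 - 3 * ρ + 2) * r ^ 2 - 4 * ρ * r
          = (ρ * (2 - (1 + ρ) * r) ^ 2 + 2 * (1 + ρ) * (1 - ρ) ^ 2 * r ^ 2) / (1 + ρ) := by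
        field_simp; ring
      have : 0 ≤ (ρ * (2 - (1 + ρ) * r) ^ 2 + 2 * (1 + ρ) * (1 - ρ) ^ 2 * r ^ 2) / (1 + ρ) := by
        positivity
      linarith
    rw [e]
    calc 16 * (ρ ^ 2 * q) = (4 * ρ * r) ^ 2 := by rw [hr2]; ring
      _ ≤ _ := by gcongr

lemma extremalAtReal_hb (hμ : 0 < μ) (hμL : μ < L) (hα : 0 < α) {g : ℝ} (hg0 : 0 < g)
    (hg1 : g < 1) (hαμ : α * μ = g ^ 2) (hαL : α * L = (2 - g) ^ 2) :
    ∃ M, ExtremalAtReal μ L α ((1 - g) ^ 2) 0 M := by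
  have hL : 0 < L := hμ.trans hμL
  refine ⟨_, extremalAtReal_of_neg_one (δ := g ^ 2) hμ hμL.le hα (by positivity) ?_
    fun l h1 hl => ?_⟩
  · linear_combination -hαL
  have hlL : α * l ≤ α * L := by gcongr
  have hml : α * μ ≤ α * l := by gcongr
  have hq : l / L * (g ^ 2) ^ 2 ≤ (g ^ 2) ^ 2 :=
    mul_le_of_le_one_left (by positivity) ((div_le_one hL).2 hl)
  have em : 2 * (1 + (1 - g) ^ 2) - α * (1 + 2 * 0) * l = g ^ 2 + ((2 - g) ^ 2 - α * l) := by ring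
  rw [em]
  have hg : 0 < g ^ 2 := by positivity
  -- Both are endpoint values minus g²; their sum 4(1 - g) is exactly 4√β, independent of l.
  refine ⟨by linarith, by nlinarith, α * l - g ^ 2, (2 - g) ^ 2 - α * l, ?_, ?_, ?_⟩
  · nlinarith
  · nlinarith
  · apply le_of_eq; ring

lemma extremalAtReal_rsHB (hμ : 0 < μ) (hα : 0 < α) {g : ℝ} (hg0 : 0 < g)
    (hg1 : g < 1) (hαμ : α * μ = g ^ 2) (hαL : α * L ≤ 1 + (1 - g) ^ 2) :
    ExtremalAtReal μ L α ((1 - g) ^ 2) 0 (α ^ 2 * μ) := by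
  refine extremalAtReal_of_one hμ hα fun l h1 hl => ?_
  have hlL : α * l ≤ α * L := by gcongr
  have hml : α * μ ≤ α * l := by gcongr
  have em : 2 * (1 + (1 - g) ^ 2) - α * (1 + 2 * 0) * l = 2 * (1 + (1 - g) ^ 2) - α * l := by ring
  rw [em, hαμ]
  have hg : 0 < g ^ 2 := by positivity
  -- Again A + B = 4(1 - g) = 4√β. The bound on α L says χ(1) ≤ χ(-1), which gives the inequality
  -- for B.
  refine ⟨by nlinarith, by nlinarith, α * l - g ^ 2, 2 * (1 + (1 - g) ^ 2) - α * l - g ^ 2,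
    ?_, ?_, ?_⟩
  · nlinarith
  · nlinarith
  · apply le_of_eq; ring

end GMM

/-! ### The listed parameters satisfy the certificates. -/

namespace GMM

variable {μ L α β ν : ℝ}

lemma IsListed.extremalAtReal (hμ : 0 < μ) (hμL : μ < L) (h : IsListed μ L α β ν) :
    ∃ M, ExtremalAtReal μ L α β ν M := by
  have hL : 0 < L := hμ.trans hμL
  obtain ⟨κ, hκ⟩ : ∃ κ, κ = L / μ := ⟨_, rfl⟩
  have hκ1 : 1 < κ := by rw [hκ]; exact (one_lt_div hμ).2 hμL
  have hLκ : L = κ * μ := by rw [hκ]; field_simp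
  obtain ⟨k, hk⟩ : ∃ k, k = √κ := ⟨_, rfl⟩
  have hkκ : κ = k ^ 2 := by rw [hk, Real.sq_sqrt (by linarith)]
  have hk1 : 1 < k := by rw [hk]; exact Real.lt_sqrt_of_sq_lt (by linarith)
  have hk0 : 0 < k := by linarith
  have hki : 1 / k < 1 := (div_lt_one hk0).2 hk1
  cases h with
  | gdPopular =>
    have e : 1 / L * L = 1 := by field_simp
    have : 1 / L * μ ≤ 1 := by rw [one_div_mul_eq_div]; exact (div_le_one hL).2 hμL.le
    exact ⟨_, extremalAtReal_gd_one hμ (by positivity) (by linarith) (by rw [e]; linarith)⟩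
  | gdFastest => exact extremalAtReal_gdFastest hμ hμL
  | rsGD => exact extremalAtReal_rsGD hμ hμL
  | nagPopular _ hβ =>
    rw [← hκ, ← hk] at hβ
    refine ⟨_, extremalAtReal_nag hμ (by positivity) (s := 1 / k) (by positivity) hki ?_ hβ ?_⟩
    · rw [hLκ, hkκ]; field_simp
    · have e : 1 / L * L = 1 := by field_simp
      have : (1 / k) ^ 2 ≤ 1 := pow_le_one₀ (by positivity) hki.le
      rw [e]; linarith
  | nagFastest _ hβ =>
    rw [← hκ] at hβ
    obtain ⟨w, hw⟩ : ∃ w, w = √(3 * κ + 1) := ⟨_, rfl⟩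
    have hw2 : w ^ 2 = 3 * κ + 1 := by rw [hw, Real.sq_sqrt (by linarith)]
    have hw0 : 2 < w := by rw [hw]; exact Real.lt_sqrt_of_sq_lt (by linarith)
    have hwp : 0 < w := by linarith
    rw [← hw] at hβ
    have h3 : 0 < 3 * κ + 1 := by linarith
    have e3 : 3 * L + μ = (3 * κ + 1) * μ := by rw [hLκ]; ring
    -- s = √(α μ) = 2 / w; for this method the bound on α L is an equality.
    refine ⟨_, extremalAtReal_nag hμ (by positivity) (s := 2 / w) (by positivity)
      ((div_lt_one hwp).2 hw0) ?_ ?_ ?_⟩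
    · rw [e3, ← hw2]; field_simp; norm_num
    · rw [hβ]; field_simp
    · rw [e3, div_pow, hw2, hLκ]; apply le_of_eq; field_simp; ring
  | nagFamily _ _ hα hαL hβ =>
    have h1 : α * L ≤ 1 := by rwa [le_div_iff₀ hL] at hαL
    have h2 : α * μ < α * L := by gcongr
    have h3 : √(α * μ) ^ 2 = α * μ := Real.sq_sqrt (by positivity)
    refine ⟨_, extremalAtReal_nag hμ hα (s := √(α * μ)) (by positivity) ?_ h3.symm hβ ?_⟩
    · rw [Real.sqrt_lt' one_pos]; linarith
    · rw [h3]; linarith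
  | tmm ρ hρ =>
    rw [← hκ, ← hk] at hρ
    have : 0 < 1 / k := by positivity
    refine extremalAtReal_tmm hμ hμL (by linarith) (by linarith) ?_
    rw [hρ, hLκ, hkκ]; field_simp; ring
  | hb =>
    rw [← hκ, ← hk]
    obtain ⟨m, hm⟩ : ∃ m, m = √μ := ⟨_, rfl⟩
    have hm0 : 0 < m := by rw [hm]; positivity
    have hm2 : μ = m ^ 2 := by rw [hm, Real.sq_sqrt hμ.le]
    have hsL : √L = k * m := by
      rw [hLκ, hkκ, hm2, ← mul_pow, Real.sqrt_sq (by positivity)]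
    have e : (k - 1) / (k + 1) = 1 - 2 / (k + 1) := by field_simp; ring
    rw [e, hsL, ← hm]
    refine extremalAtReal_hb hμ hμL (by positivity) (by positivity) ?_ ?_ ?_
    · rw [div_lt_one (by positivity)]; linarith
    · rw [hm2]; field_simp; norm_num
    · rw [hLκ, hkκ, hm2]; field_simp; ring
  | rsHB =>
    rw [← hκ, ← hk]
    suffices h : 0 < rshbCoeff κ ∧ rshbCoeff κ / k < 1 ∧
        rshbCoeff κ ^ 2 ≤ 1 + (1 - rshbCoeff κ / k) ^ 2 by
      obtain ⟨h0, h1, h2⟩ := h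
      refine ⟨_, extremalAtReal_rsHB hμ (by positivity) (by positivity) h1 ?_ ?_⟩
      · rw [hLκ, hkκ]; field_simp
      · rwa [div_mul_cancel₀ _ hL.ne']
    unfold rshbCoeff
    split_ifs
    · obtain ⟨w, hw⟩ : ∃ w, w = √(2 * κ - 1) := ⟨_, rfl⟩
      have hw2 : w ^ 2 = 2 * κ - 1 := by rw [hw, Real.sq_sqrt (by linarith)]
      have hw0 : 1 < w := by rw [hw]; exact Real.lt_sqrt_of_sq_lt (by linarith)
      have hκw : κ = (w ^ 2 + 1) / 2 := by linarith
      have hwm : w - 1 ≠ 0 := by linarith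
      -- Rationalization, giving g = 2 / (w + 1); the last requirement then becomes the equality α L
      -- = 1 + β.
      have e1 : k * (w - 1) / (κ - 1) = k * (2 / (w + 1)) := by
        have : κ - 1 = (w - 1) * (w + 1) / 2 := by rw [hκw]; ring
        have : w + 1 ≠ 0 := by linarith
        rw [‹κ - 1 = _›]; field_simp
      rw [← hk, ← hw, e1, mul_div_cancel_left₀ _ hk0.ne']
      refine ⟨by positivity, ?_, ?_⟩
      · rw [div_lt_one (by positivity)]; linarith
      · rw [mul_pow, ← hkκ, hκw]; apply le_of_eq; field_simp; ring
    · exact ⟨one_pos, hki, by nlinarith [sq_nonneg (1 - 1 / k)]⟩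

end GMM

/-! ### Scalar second-order recurrences: stability, dissipation and resonance. -/

namespace GMM

/-- Convexity gives (|r||v| + |u|)² ≤ |r||v|² + |u|²/(1 - |r|), and summing yields partial sums
bounded uniformly in N. -/
lemma summable_norm_sq_of_first_order {r : ℂ} (hr : ‖r‖ < 1) {v u : ℕ → ℂ}
    (hv : ∀ k, v (k + 1) = r * v k + u k) (hu : Summable fun k => ‖u k‖ ^ 2) :
    Summable fun k => ‖v k‖ ^ 2 := by
  have hr' : 0 < 1 - ‖r‖ := by linarith
  have step : ∀ k, ‖v (k + 1)‖ ^ 2 ≤ ‖r‖ * ‖v k‖ ^ 2 + ‖u k‖ ^ 2 / (1 - ‖r‖) := by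
    intro k
    have h1 : ‖v (k + 1)‖ ≤ ‖r‖ * ‖v k‖ + ‖u k‖ := by
      rw [hv, ← norm_mul]; exact norm_add_le _ _
    have h2 : ‖v (k + 1)‖ ^ 2 ≤ (‖r‖ * ‖v k‖ + ‖u k‖) ^ 2 := by gcongr
    have h3 : ‖r‖ * ‖v k‖ ^ 2 + ‖u k‖ ^ 2 / (1 - ‖r‖) - (‖r‖ * ‖v k‖ + ‖u k‖) ^ 2
        = ‖r‖ * ((1 - ‖r‖) * ‖v k‖ - ‖u k‖) ^ 2 / (1 - ‖r‖) := by
      field_simp; ring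
    have h4 : 0 ≤ ‖r‖ * ((1 - ‖r‖) * ‖v k‖ - ‖u k‖) ^ 2 / (1 - ‖r‖) := by positivity
    linarith
  have bound : ∀ N, ∑ k ∈ Finset.range N, ‖v k‖ ^ 2
      ≤ (‖v 0‖ ^ 2 + (∑' k, ‖u k‖ ^ 2) / (1 - ‖r‖)) / (1 - ‖r‖) := by
    intro N
    have hU : 0 ≤ ∑' k, ‖u k‖ ^ 2 := tsum_nonneg fun _ => by positivity
    induction N with
    | zero => simp only [Finset.range_zero, Finset.sum_empty]; positivity
    | succ N ih =>
      have h5 : ∑ k ∈ Finset.range N, ‖v (k + 1)‖ ^ 2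
          ≤ ‖r‖ * ∑ k ∈ Finset.range N, ‖v k‖ ^ 2
            + (∑ k ∈ Finset.range N, ‖u k‖ ^ 2) / (1 - ‖r‖) := by
        rw [Finset.mul_sum, Finset.sum_div, ← Finset.sum_add_distrib]
        exact Finset.sum_le_sum fun k _ => step k
      have h6 : (∑ k ∈ Finset.range N, ‖u k‖ ^ 2) / (1 - ‖r‖)
          ≤ (∑' k, ‖u k‖ ^ 2) / (1 - ‖r‖) := by
        gcongr
        exact hu.sum_le_tsum _ fun _ _ => by positivity
      have h7 := mul_le_mul_of_nonneg_left ih (norm_nonneg r)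
      rw [Finset.sum_range_succ']
      obtain ⟨c, hc⟩ : ∃ c, c = ‖v 0‖ ^ 2 + (∑' k, ‖u k‖ ^ 2) / (1 - ‖r‖) := ⟨_, rfl⟩
      rw [← hc] at h7 ⊢
      have h8 : c / (1 - ‖r‖) = ‖r‖ * (c / (1 - ‖r‖)) + c := by field_simp; ring
      linarith
  exact summable_of_sum_range_le (fun _ => by positivity) bound

namespace StableWithMargin

variable {a b m : ℝ}

/-- Jury's criterion. A nonreal root has |r|² = b < 1; a real root x ≥ 1 satisfies (x - 1)(x - b) ≥
0, against χ(1) > 0, and symmetrically for x ≤ -1. -/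
lemma norm_root_lt_one (h : StableWithMargin a b m) {r : ℂ} (hr : r ^ 2 - a * r + b = 0) :
    ‖r‖ < 1 := by
  obtain ⟨h1, h2, h3, -⟩ := h
  have hre := congrArg Complex.re hr
  have him := congrArg Complex.im hr
  obtain ⟨x, y⟩ := r
  simp only [pow_two, Complex.add_re, Complex.sub_re, Complex.mul_re, Complex.ofReal_re,
    Complex.ofReal_im, Complex.zero_re, Complex.add_im, Complex.sub_im, Complex.mul_im,
    Complex.zero_im] at hre him
  have hn : ‖(⟨x, y⟩ : ℂ)‖ ^ 2 = x * x + y * y := by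
    rw [← Complex.normSq_eq_norm_sq, Complex.normSq_mk]
  have : x * x + y * y < 1 := by
    have hy : y * (2 * x - a) = 0 := by linarith
    rcases mul_eq_zero.1 hy with hy | hy
    · subst hy
      by_contra hc
      have hx : 1 ≤ x * x := by linarith
      rcases le_total 0 x with h0 | h0
      · have : 1 ≤ x := by nlinarith
        nlinarith [mul_nonneg (sub_nonneg.2 this) (by linarith : 0 ≤ x - b)]
      · have : 1 ≤ -x := by nlinarith
        nlinarith [mul_nonneg (sub_nonneg.2 this) (by linarith : 0 ≤ -x - b)]
    · have : a = 2 * x := by linarith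
      subst this
      nlinarith
  nlinarith [norm_nonneg (⟨x, y⟩ : ℂ)]

lemma exists_roots (h : StableWithMargin a b m) :
    ∃ r s : ℂ, ‖r‖ < 1 ∧ ‖s‖ < 1 ∧ r + s = a ∧ r * s = b := by
  obtain ⟨w, hw⟩ := IsAlgClosed.exists_pow_nat_eq ((a : ℂ) ^ 2 - 4 * b) two_pos
  refine ⟨(a + w) / 2, (a - w) / 2, h.norm_root_lt_one ?_, h.norm_root_lt_one ?_, by ring, ?_⟩
  · linear_combination hw / 4
  · linear_combination hw / 4
  · linear_combination -hw / 4

lemma le_norm_sq_of_norm_eq_one (h : StableWithMargin a b m) {z : ℂ} (hz : ‖z‖ = 1) :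
    m ≤ ‖z ^ 2 - a * z + b‖ ^ 2 := by
  obtain ⟨A, B, hA, hB, hAB⟩ := h.certificate
  have hz2 : Complex.normSq z = 1 := by rw [Complex.normSq_eq_norm_sq, hz, one_pow]
  rw [← Complex.normSq_eq_norm_sq]
  obtain ⟨x, y⟩ := z
  simp only [Complex.normSq_apply, pow_two, Complex.add_re, Complex.sub_re, Complex.mul_re,
    Complex.ofReal_re, Complex.ofReal_im, Complex.add_im, Complex.sub_im, Complex.mul_im] at hz2 ⊢
  have hx1 : 0 ≤ 1 + x := by nlinarith
  have hx2 : 0 ≤ 1 - x := by nlinarith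
  have e : ((x * x - y * y - (a * x - 0 * y) + b) * (x * x - y * y - (a * x - 0 * y) + b)
      + (x * y + y * x - (a * y + 0 * x) + 0) * (x * y + y * x - (a * y + 0 * x) + 0))
      = m + ((1 - a + b) ^ 2 - (A ^ 2 + m)) * ((1 + x) / 2)
        + ((1 + a + b) ^ 2 - (B ^ 2 + m)) * ((1 - x) / 2)
        + ((A + B) ^ 2 - 16 * b) * ((1 + x) / 2 * ((1 - x) / 2))
        + (A * ((1 + x) / 2) - B * ((1 - x) / 2)) ^ 2 := by
    have hy : y * y = 1 - x * x := by linarith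
    linear_combination (x ^ 2 + y ^ 2 + 1 + a ^ 2 - 2 * a * x - 2 * b) * hy
  rw [e]
  have t1 := mul_nonneg (sub_nonneg.2 hA) (by linarith : 0 ≤ (1 + x) / 2)
  have t2 := mul_nonneg (sub_nonneg.2 hB) (by linarith : 0 ≤ (1 - x) / 2)
  have t3 := mul_nonneg (sub_nonneg.2 hAB)
    (mul_nonneg (by linarith : 0 ≤ (1 + x) / 2) (by linarith : 0 ≤ (1 - x) / 2))
  have t4 := sq_nonneg (A * ((1 + x) / 2) - B * ((1 - x) / 2))
  linarith

end StableWithMargin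

/-- The difference of the two sides is (R - 1)(R - |r|²). -/
lemma mul_norm_sub_sq_le {R : ℝ} (hR : 1 ≤ R) {u r : ℂ} (hu : ‖u‖ = 1) (hr : ‖r‖ < 1) :
    R * ‖u - r‖ ^ 2 ≤ ‖R * u - r‖ ^ 2 := by
  have hu2 : Complex.normSq u = 1 := by rw [Complex.normSq_eq_norm_sq, hu, one_pow]
  have hr2 : Complex.normSq r ≤ 1 := by
    rw [Complex.normSq_eq_norm_sq]; exact pow_le_one₀ (norm_nonneg _) hr.le
  rw [← Complex.normSq_eq_norm_sq, ← Complex.normSq_eq_norm_sq]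
  obtain ⟨c, s⟩ := u
  obtain ⟨p, q⟩ := r
  simp only [Complex.normSq_apply, Complex.sub_re, Complex.sub_im, Complex.mul_re,
    Complex.ofReal_re, Complex.ofReal_im, Complex.mul_im] at hu2 hr2 ⊢
  have h := mul_nonneg (sub_nonneg.2 hR) (by linarith : 0 ≤ R - (p * p + q * q))
  have hs : s * s = 1 - c * c := by linarith
  linear_combination h + (R - R ^ 2) * hs

/-- Moving radially outward from z / |z|, each root factor gains at least |z| in squared modulus.
The resulting |z|² later absorbs the factor z in the output of an eigenvector (z y, y). -/
lemma StableWithMargin.mul_sq_le_norm_sq {a b m : ℝ} (h : StableWithMargin a b m) {z : ℂ}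
    (hz : 1 ≤ ‖z‖) : m * ‖z‖ ^ 2 ≤ ‖z ^ 2 - a * z + b‖ ^ 2 := by
  obtain ⟨r, s, hr, hs, h1, h2⟩ := h.exists_roots
  have hz0 : 0 < ‖z‖ := by linarith
  obtain ⟨u, hu⟩ : ∃ u : ℂ, u = z / ‖z‖ := ⟨_, rfl⟩
  have hzc : (‖z‖ : ℂ) ≠ 0 := by exact_mod_cast hz0.ne'
  have hu1 : ‖u‖ = 1 := by
    rw [hu, norm_div, Complex.norm_real, norm_norm, div_self hz0.ne']
  have hzu : z = ‖z‖ * u := by rw [hu]; field_simp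
  have fac : ∀ y : ℂ, y ^ 2 - a * y + b = (y - r) * (y - s) := by
    intro y; rw [← h1, ← h2]; ring
  have key := h.le_norm_sq_of_norm_eq_one hu1
  rw [fac, norm_mul, mul_pow] at key ⊢
  have k1 := mul_norm_sub_sq_le hz hu1 hr
  have k2 := mul_norm_sub_sq_le hz hu1 hs
  rw [← hzu] at k1 k2
  calc m * ‖z‖ ^ 2 ≤ (‖u - r‖ ^ 2 * ‖u - s‖ ^ 2) * ‖z‖ ^ 2 := by gcongr
    _ = (‖z‖ * ‖u - r‖ ^ 2) * (‖z‖ * ‖u - s‖ ^ 2) := by ring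
    _ ≤ _ := by gcongr

/-- The recurrence factors into two stable first-order ones over ℂ, through x (k + 1) - r x k. -/
lemma StableWithMargin.summable_sq {a b m : ℝ} (h : StableWithMargin a b m) {x u : ℕ → ℝ}
    (hx : ∀ k, x (k + 2) = a * x (k + 1) - b * x k + u k) (hu : Summable fun k => u k ^ 2) :
    Summable fun k => x k ^ 2 := by
  obtain ⟨r, s, hr, hs, h1, h2⟩ := h.exists_roots
  have hv : Summable fun k => ‖(x (k + 1) : ℂ) - r * x k‖ ^ 2 := by
    refine summable_norm_sq_of_first_order (u := fun k => (u k : ℂ)) hs (fun k => ?_) ?_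
    · have e : (x (k + 1 + 1) : ℂ) = a * x (k + 1) - b * x k + u k := by exact_mod_cast hx k
      rw [e, ← h1, ← h2]; ring
    · simpa using hu
  have := summable_norm_sq_of_first_order (v := fun k => (x k : ℂ))
    (u := fun k => (x (k + 1) : ℂ) - r * x k) hr (fun k => by ring) hv
  simpa using this

/-- The dissipation inequality of a stable mode, summed along trajectories. -/
lemma StableWithMargin.exists_storage {a b m : ℝ} (h : StableWithMargin a b m) :
    ∃ V : ℝ → ℝ → ℝ, V 0 0 = 0 ∧ (∀ x y, 0 ≤ V x y) ∧ ∀ x u : ℕ → ℝ,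
      (∀ k, x (k + 2) = a * x (k + 1) - b * x k + u k) → (Summable fun k => u k ^ 2) →
      (Summable fun k => x (k + 1) ^ 2) ∧
      m * ∑' k, x (k + 1) ^ 2 ≤ ∑' k, u k ^ 2 + V (x 1) (x 0) := by
  obtain ⟨A, B, hA, hB, hAB⟩ := h.certificate
  obtain ⟨c₁, hc₁⟩ : ∃ c, c = (1 - a + b) ^ 2 - (A ^ 2 + m) := ⟨_, rfl⟩
  obtain ⟨c₂, hc₂⟩ : ∃ c, c = (1 + a + b) ^ 2 - (B ^ 2 + m) := ⟨_, rfl⟩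
  obtain ⟨c₃, hc₃⟩ : ∃ c, c = (A + B) ^ 2 - 16 * b := ⟨_, rfl⟩
  have hc₁0 : 0 ≤ c₁ := by linarith
  have hc₂0 : 0 ≤ c₂ := by linarith
  have hc₃0 : 0 ≤ c₃ := by linarith
  -- The telescoping remainder when the certificate is read with z as the shift: p, q and p q become
  -- the squares of (x + y)/2, (x - y)/2 and (x - w)/4.
  obtain ⟨W, hW⟩ : ∃ W : ℝ → ℝ → ℝ, W = fun x y =>
      (1 - c₁ / 4 - c₂ / 4 - c₃ / 16 - (A + B) ^ 2 / 16) * x ^ 2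
      + (-2 * a - (c₁ - c₂) / 2 - (A ^ 2 - B ^ 2) / 4) * (x * y)
      + ((c₃ + (A + B) ^ 2) / 16 - b ^ 2) * y ^ 2 := ⟨_, rfl⟩
  have diss : ∀ x y w : ℝ, m * y ^ 2 + W x y ≤ (x - a * y + b * w) ^ 2 + W y w := by
    intro x y w
    have e : (x - a * y + b * w) ^ 2 + W y w - (m * y ^ 2 + W x y)
        = c₁ * ((x + y) / 2) ^ 2 + c₂ * ((x - y) / 2) ^ 2 + c₃ * ((x - w) / 4) ^ 2
          + (A * (x + 2 * y + w) / 4 - B * (2 * y - x - w) / 4) ^ 2 := by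
      rw [hW, hc₁, hc₂, hc₃]; ring
    have : 0 ≤ c₁ * ((x + y) / 2) ^ 2 + c₂ * ((x - y) / 2) ^ 2 + c₃ * ((x - w) / 4) ^ 2
          + (A * (x + 2 * y + w) / 4 - B * (2 * y - x - w) / 4) ^ 2 := by positivity
    linarith
  -- No sign of W is needed: its terminal value tends to 0 along square-summable trajectories, so
  -- |W| bounds the initial cost.
  refine ⟨fun x y => |W x y|, by simp [hW], fun _ _ => abs_nonneg _, fun x u hx hu => ?_⟩
  have hs := h.summable_sq hx hu
  have hs1 : Summable fun k => x (k + 1) ^ 2 := (summable_nat_add_iff 1).2 hs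
  refine ⟨hs1, ?_⟩
  have hsum : ∀ N, m * ∑ k ∈ Finset.range N, x (k + 1) ^ 2
      ≤ ∑ k ∈ Finset.range N, u k ^ 2 + W (x 1) (x 0) - W (x (N + 1)) (x N) := by
    intro N
    induction N with
    | zero => simp
    | succ N ih =>
      rw [Finset.sum_range_succ, Finset.sum_range_succ, mul_add]
      have := diss (x (N + 2)) (x (N + 1)) (x N)
      have e : x (N + 2) - a * x (N + 1) + b * x N = u N := by rw [hx]; ring
      rw [e] at this
      linarith
  have hx0 : Filter.Tendsto x Filter.atTop (nhds 0) := by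
    have := hs.tendsto_atTop_zero
    rw [tendsto_zero_iff_abs_tendsto_zero]
    simpa [Real.sqrt_sq_eq_abs, Function.comp_def] using this.sqrt
  have hW0 : Filter.Tendsto (fun N => W (x (N + 1)) (x N)) Filter.atTop (nhds 0) := by
    have hx1 : Filter.Tendsto (fun N => x (N + 1)) Filter.atTop (nhds 0) :=
      hx0.comp (Filter.tendsto_add_atTop_nat 1)
    have hc : Continuous fun q : ℝ × ℝ => W q.1 q.2 := by rw [hW]; fun_prop
    have := (hc.tendsto (0, 0)).comp (hx1.prodMk_nhds hx0)
    simpa [hW, Function.comp_def] using this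
  have l1 := (hs1.hasSum.tendsto_sum_nat).const_mul m
  have l2 := ((hu.hasSum.tendsto_sum_nat).add_const (W (x 1) (x 0))).sub hW0
  have := le_of_tendsto_of_tendsto' l1 l2 hsum
  have := le_abs_self (W (x 1) (x 0))
  linarith

/-- The response to the resonant input `z ^ k`, `z = ±1`, has the amplitude predicted by the
transfer function. -/
lemma StableWithMargin.le_of_forall_sum_le {a b m : ℝ} (h : StableWithMargin a b m) {z : ℝ}
    (hz : z = 1 ∨ z = -1) {x : ℕ → ℝ} (hx : ∀ k, x (k + 2) = a * x (k + 1) - b * x k + z ^ k)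
    {C D : ℝ} (hC : ∀ N : ℕ, C * ∑ k ∈ Finset.range N, x (k + 1) ^ 2 ≤ D * N) :
    C ≤ D * (z ^ 2 - a * z + b) ^ 2 := by
  have hχ : z ^ 2 - a * z + b ≠ 0 := by
    rcases hz with rfl | rfl
    · have := h.pos_one; intro h0; linarith
    · have := h.pos_neg_one; intro h0; linarith
  obtain ⟨χ, hχe⟩ : ∃ χ, χ = z ^ 2 - a * z + b := ⟨_, rfl⟩
  rw [← hχe] at hχ ⊢
  have hzk : ∀ k, (z ^ k) ^ 2 = 1 := by
    intro k; rw [← pow_mul, mul_comm, pow_mul]; rcases hz with rfl | rfl <;> simp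
  -- The deviation from the steady state z^k / χ(z) solves the homogeneous recurrence.
  have hs : Summable fun k => (x k - z ^ k / χ) ^ 2 := by
    refine h.summable_sq (u := fun _ => 0) (fun k => ?_) (by simp)
    rw [hx]
    have e : z ^ (k + 2) / χ = a * (z ^ (k + 1) / χ) - b * (z ^ k / χ) + z ^ k := by
      field_simp; rw [hχe]; ring
    rw [e]; ring
  have h0 : Filter.Tendsto (fun k => x k - z ^ k / χ) Filter.atTop (nhds 0) := by
    rw [tendsto_zero_iff_abs_tendsto_zero]
    simpa [Real.sqrt_sq_eq_abs, Function.comp_def] using hs.tendsto_atTop_zero.sqrt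
  have h1 : Filter.Tendsto (fun k => (x k * z ^ k) ^ 2) Filter.atTop (nhds ((1 / χ) ^ 2)) := by
    have hd : Filter.Tendsto (fun k => x k * z ^ k - 1 / χ) Filter.atTop (nhds 0) := by
      rw [tendsto_zero_iff_abs_tendsto_zero] at h0 ⊢
      refine h0.congr fun k => ?_
      have e : x k * z ^ k - 1 / χ = (x k - z ^ k / χ) * z ^ k := by
        rw [sub_mul, div_mul_eq_mul_div, ← pow_two, hzk]
      have e1 : |z ^ k| = 1 := by
        rw [abs_pow]; rcases hz with rfl | rfl <;> simp
      simp only [Function.comp_def]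
      rw [e, abs_mul, e1, mul_one]
    have := (hd.add_const (1 / χ)).pow 2
    simpa using this
  have h2 : Filter.Tendsto (fun k => x (k + 1) ^ 2) Filter.atTop (nhds ((1 / χ) ^ 2)) := by
    have := h1.comp (Filter.tendsto_add_atTop_nat 1)
    refine this.congr fun k => ?_
    simp only [Function.comp_def]
    rw [mul_pow, hzk, mul_one]
  have h3 := h2.cesaro.const_mul C
  have h4 : C * (1 / χ) ^ 2 ≤ D := by
    refine le_of_tendsto h3 ?_
    filter_upwards [Filter.eventually_gt_atTop 0] with N hN
    have hN' : (0 : ℝ) < N := by exact_mod_cast hN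
    have := hC N
    calc C * ((N : ℝ)⁻¹ * ∑ i ∈ Finset.range N, x (i + 1) ^ 2)
        = (C * ∑ i ∈ Finset.range N, x (i + 1) ^ 2) / N := by ring
      _ ≤ D := by rwa [div_le_iff₀ hN']
  have h5 : 0 < χ ^ 2 := by positivity
  calc C = C * (1 / χ) ^ 2 * χ ^ 2 := by field_simp
    _ ≤ D * χ ^ 2 := by gcongr

end GMM

/-! ### Diagonalization and the lower bound on destabilizing perturbations. -/

namespace GMM

variable {d : ℕ} {U : Matrix (Fin d) (Fin d) ℝ} {lam : Fin d → ℝ} {α β ν M : ℝ}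

/-- The characteristic polynomial of the mode with eigenvalue `l`, at a complex point. -/
def modeChar (α β ν l : ℝ) (z : ℂ) : ℂ := z ^ 2 - modeA α β ν l * z + modeB α β ν l

lemma exists_eigenvector_of_mem_spectrum {n : Type*} [Fintype n] [DecidableEq n]
    {N : Matrix n n ℂ} {z : ℂ} (hz : z ∈ spectrum ℂ N) : ∃ v, v ≠ 0 ∧ N *ᵥ v = z • v := by
  rw [spectrum.mem_iff, Matrix.isUnit_iff_isUnit_det, isUnit_iff_ne_zero, not_not,
    ← Matrix.exists_mulVec_eq_zero_iff] at hz
  obtain ⟨v, hv, h⟩ := hz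
  refine ⟨v, hv, ?_⟩
  rw [Algebra.algebraMap_eq_smul_one, Matrix.sub_mulVec, Matrix.smul_mulVec, Matrix.one_mulVec,
    sub_eq_zero] at h
  exact h.symm

lemma mem_spectrum_of_eigenvector {n : Type*} [Fintype n] [DecidableEq n]
    {N : Matrix n n ℂ} {z : ℂ} {v : n → ℂ} (hv : v ≠ 0) (h : N *ᵥ v = z • v) :
    z ∈ spectrum ℂ N := by
  rw [spectrum.mem_iff, Matrix.isUnit_iff_isUnit_det, isUnit_iff_ne_zero, not_not,
    ← Matrix.exists_mulVec_eq_zero_iff]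
  refine ⟨v, hv, ?_⟩
  rw [Algebra.algebraMap_eq_smul_one, Matrix.sub_mulVec, Matrix.smul_mulVec, Matrix.one_mulVec,
    h, sub_self]

lemma toC_mul {l m n : Type*} [Fintype m] (A : Matrix l m ℝ) (B : Matrix m n ℝ) :
    toC (A * B) = toC A * toC B :=
  Matrix.map_mul (f := Complex.ofRealHom)

lemma toC_add {m n : Type*} (A B : Matrix m n ℝ) : toC (A + B) = toC A + toC B := by
  ext; simp

lemma toC_diagonal {n : Type*} [DecidableEq n] (f : n → ℝ) :
    toC (diagonal f) = diagonal fun i => (f i : ℂ) := by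
  simp only [toC, Matrix.diagonal_map Complex.ofReal_zero]

lemma toC_one {n : Type*} [DecidableEq n] : toC (1 : Matrix n n ℝ) = 1 := by
  rw [← diagonal_one, toC_diagonal]; simp

lemma toC_AQ (Q : Matrix (Fin d) (Fin d) ℝ) : toC (AQ Q α β ν) =
    fromBlocks ((1 + β : ℂ) • 1 - (α * (1 + ν) : ℂ) • toC Q) (-(β : ℂ) • 1 + (α * ν : ℂ) • toC Q)
      1 0 := by
  unfold AQ toC
  rw [fromBlocks_map]
  congr 1 <;> ext i j <;> by_cases h : i = j <;> simp [h, Matrix.one_apply]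

lemma toC_Bmat : toC (Bmat d α) = fromRows (-(α : ℂ) • 1) 0 := by
  ext i j
  rcases i with i | i
  · by_cases h : i = j <;> simp [Bmat, h]
  · simp [Bmat]

lemma toC_Tmat : toC (Tmat U lam) =
    fromCols ((diagonal fun i => ((√(lam i) / √2 : ℝ) : ℂ)) * toC Uᵀ) 0 := by
  ext i j
  rcases j with j | j
  · simp [Tmat, Matrix.diagonal_mul]; ring
  · simp [Tmat]

lemma toC_transpose_mul_self (hU : U ∈ Matrix.orthogonalGroup (Fin d) ℝ) :
    toC Uᵀ * toC U = 1 := by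
  rw [← toC_mul, (Matrix.mem_orthogonalGroup_iff' _ _).1 hU, toC_one]

lemma toC_mul_transpose_self (hU : U ∈ Matrix.orthogonalGroup (Fin d) ℝ) :
    toC U * toC Uᵀ = 1 := by
  rw [← toC_mul, (Matrix.mem_orthogonalGroup_iff _ _).1 hU, toC_one]

lemma toC_transpose_mem_unitary (hU : U ∈ Matrix.orthogonalGroup (Fin d) ℝ) :
    toC Uᵀ ∈ unitary (Matrix (Fin d) (Fin d) ℂ) := by
  have e : star (toC Uᵀ) = toC U := by ext; simp [Matrix.star_apply]
  rw [Unitary.mem_iff, e]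
  exact ⟨toC_mul_transpose_self hU, toC_transpose_mul_self hU⟩

/-- An eigenvector of the perturbed system, read in the coordinates of the modes. -/
lemma eigenvector_modes (hU : U ∈ Matrix.orthogonalGroup (Fin d) ℝ)
    {Δ : Matrix (Fin d) (Fin d) ℂ} {z : ℂ} {v : Fin d ⊕ Fin d → ℂ}
    (hv : (toC (AQ (U * diagonal lam * Uᵀ) α β ν) + toC (Bmat d α) * Δ * toC (Tmat U lam)) *ᵥ v
      = z • v) :
    v ∘ Sum.inl = z • (v ∘ Sum.inr) ∧
    ∀ i, modeChar α β ν (lam i) z * (toC Uᵀ *ᵥ (v ∘ Sum.inr)) i =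
      -α * ((toC Uᵀ * Δ) *ᵥ
        fun i => ((√(lam i) / √2 : ℝ) : ℂ) * z * (toC Uᵀ *ᵥ (v ∘ Sum.inr)) i) i := by
  rw [toC_AQ, toC_Bmat, toC_Tmat, Matrix.add_mulVec, Matrix.fromBlocks_mulVec,
    ← Matrix.mulVec_mulVec, ← Matrix.mulVec_mulVec, Matrix.fromCols_mulVec,
    Matrix.fromRows_mulVec] at hv
  have h2 : v ∘ Sum.inl = z • (v ∘ Sum.inr) := by
    ext i
    have := congrFun hv (Sum.inr i)
    simpa using this
  refine ⟨h2, fun i => ?_⟩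
  have h1 : ((1 + β : ℂ) • 1 - (α * (1 + ν) : ℂ) • toC (U * diagonal lam * Uᵀ)) *ᵥ (v ∘ Sum.inl)
      + (-(β : ℂ) • 1 + (α * ν : ℂ) • toC (U * diagonal lam * Uᵀ)) *ᵥ (v ∘ Sum.inr)
      + (-(α : ℂ) • (1 : Matrix (Fin d) (Fin d) ℂ)) *ᵥ Δ *ᵥ
        ((diagonal (fun i => ((√(lam i) / √2 : ℝ) : ℂ)) * toC Uᵀ) *ᵥ (v ∘ Sum.inl))
      = z • (v ∘ Sum.inl) := by
    ext i
    have := congrFun hv (Sum.inl i)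
    simpa using this
  rw [h2] at h1
  generalize v ∘ Sum.inr = y at h1 ⊢
  have h3 := congrFun (congrArg (toC Uᵀ *ᵥ ·) h1) i
  have hQ : ∀ y, toC Uᵀ *ᵥ (toC (U * diagonal lam * Uᵀ) *ᵥ y)
      = fun i => (lam i : ℂ) * (toC Uᵀ *ᵥ y) i := by
    intro y
    rw [toC_mul, toC_mul, Matrix.mulVec_mulVec, ← mul_assoc, ← mul_assoc,
      toC_transpose_mul_self hU, one_mul, ← Matrix.mulVec_mulVec, toC_diagonal]
    ext i; rw [Matrix.mulVec_diagonal]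
  have hT : (diagonal (fun i => ((√(lam i) / √2 : ℝ) : ℂ)) * toC Uᵀ) *ᵥ (z • y)
      = fun i => ((√(lam i) / √2 : ℝ) : ℂ) * z * (toC Uᵀ *ᵥ y) i := by
    rw [Matrix.mulVec_smul, ← Matrix.mulVec_mulVec]
    ext i
    rw [Pi.smul_apply, Matrix.mulVec_diagonal, smul_eq_mul]; ring
  simp only [hT, Matrix.mulVec_add, Matrix.add_mulVec, Matrix.sub_mulVec, Matrix.smul_mulVec,
    Matrix.one_mulVec, Matrix.mulVec_smul, Matrix.mulVec_sub, hQ, Pi.add_apply, Pi.smul_apply,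
    Pi.sub_apply, smul_eq_mul, Matrix.mulVec_mulVec _ (toC Uᵀ) Δ] at h3
  unfold modeChar modeA modeB
  simp only [Complex.ofReal_add, Complex.ofReal_sub, Complex.ofReal_mul, Complex.ofReal_one]
  linear_combination -h3

lemma mulVec_norm_sq_le {n : Type*} [Fintype n] [DecidableEq n] (N : Matrix n n ℂ) (s : n → ℂ) :
    ∑ i, ‖(N *ᵥ s) i‖ ^ 2 ≤ ‖N‖ ^ 2 * ∑ i, ‖s i‖ ^ 2 := by
  have h := Matrix.l2_opNorm_mulVec N (WithLp.toLp 2 s)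
  have h' := pow_le_pow_left₀ (norm_nonneg _) h 2
  rw [mul_pow, EuclideanSpace.norm_sq_eq, EuclideanSpace.norm_sq_eq] at h'
  simpa using h'

/-- An unstable eigenvalue requires a large perturbation. -/
lemma two_mul_le_of_mem_spectrum (hU : U ∈ Matrix.orthogonalGroup (Fin d) ℝ)
    (hpos : ∀ i, 0 < lam i)
    (hM : ∀ i, StableWithMargin (modeA α β ν (lam i)) (modeB α β ν (lam i)) (lam i * M))
    {Δ : Matrix (Fin d) (Fin d) ℂ} {z : ℂ} (hz : 1 ≤ ‖z‖)
    (hs : z ∈ spectrum ℂ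
      (toC (AQ (U * diagonal lam * Uᵀ) α β ν) + toC (Bmat d α) * Δ * toC (Tmat U lam))) :
    2 * M ≤ (α * ‖Δ‖) ^ 2 := by
  obtain ⟨v, hv0, hv⟩ := exists_eigenvector_of_mem_spectrum hs
  obtain ⟨hx, hy⟩ := eigenvector_modes hU hv
  obtain ⟨y, hye⟩ : ∃ y, y = toC Uᵀ *ᵥ (v ∘ Sum.inr) := ⟨_, rfl⟩
  rw [← hye] at hy
  have hy0 : ∃ i, y i ≠ 0 := by
    by_contra! hc
    have h0 : y = 0 := funext hc
    have h1 : v ∘ Sum.inr = 0 := by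
      have := congrArg (toC U *ᵥ ·) hye
      simpa [h0, Matrix.mulVec_mulVec, toC_mul_transpose_self hU] using this.symm
    apply hv0
    rw [h1, smul_zero] at hx
    ext i
    rcases i with i | i
    · exact congrFun hx i
    · exact congrFun h1 i
  obtain ⟨j, hj⟩ := hy0
  obtain ⟨S, hS⟩ : ∃ S, S = ∑ i, lam i * ‖z‖ ^ 2 * ‖y i‖ ^ 2 := ⟨_, rfl⟩
  have hS0 : 0 < S := by
    rw [hS]
    refine Finset.sum_pos' (fun i _ => ?_) ⟨j, Finset.mem_univ _, ?_⟩
    · have := hpos i; positivity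
    · have := hpos j; have : 0 < ‖z‖ := by linarith
      have := norm_pos_iff.2 hj
      positivity
  have h1 : M * S ≤ ∑ i, ‖modeChar α β ν (lam i) z * y i‖ ^ 2 := by
    rw [hS, Finset.mul_sum]
    refine Finset.sum_le_sum fun i _ => ?_
    rw [norm_mul, mul_pow]
    have := mul_le_mul_of_nonneg_right ((hM i).mul_sq_le_norm_sq hz) (sq_nonneg ‖y i‖)
    unfold modeChar
    linarith
  simp only [hy, norm_mul, norm_neg, mul_pow, ← Finset.mul_sum] at h1
  have h2 := mulVec_norm_sq_le (toC Uᵀ * Δ) fun i => ((√(lam i) / √2 : ℝ) : ℂ) * z * y i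
  rw [CStarRing.norm_mem_unitary_mul _ (toC_transpose_mem_unitary hU)] at h2
  have h3 : ∑ i, ‖((√(lam i) / √2 : ℝ) : ℂ) * z * y i‖ ^ 2 = S / 2 := by
    rw [hS, Finset.sum_div]
    refine Finset.sum_congr rfl fun i _ => ?_
    rw [norm_mul, norm_mul, Complex.norm_real, mul_pow, mul_pow, Real.norm_eq_abs, sq_abs, div_pow,
      Real.sq_sqrt (hpos i).le, Real.sq_sqrt (by norm_num)]
    ring
  rw [h3] at h2
  have h4 : M * S ≤ α ^ 2 * (‖Δ‖ ^ 2 * (S / 2)) := by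
    refine h1.trans ?_
    rw [Complex.norm_real, Real.norm_eq_abs, sq_abs]
    gcongr
  have h5 : (2 * M) * S ≤ (α * ‖Δ‖) ^ 2 * S := by linarith
  exact le_of_mul_le_mul_right h5 hS0

/-- A real matrix acts separately on real and imaginary parts, whose squared norms add. -/
lemma norm_toC_le (Δ : Matrix (Fin d) (Fin d) ℝ) : ‖toC Δ‖ ≤ ‖Δ‖ := by
  rw [Matrix.l2_opNorm_def (toC Δ)]
  refine ContinuousLinearMap.opNorm_le_bound _ (norm_nonneg _) fun v => ?_
  refine le_of_sq_le_sq ?_ (by positivity)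
  have hr := pow_le_pow_left₀ (norm_nonneg _)
    (Matrix.l2_opNorm_mulVec Δ (WithLp.toLp 2 fun i => (v i).re)) 2
  have hi := pow_le_pow_left₀ (norm_nonneg _)
    (Matrix.l2_opNorm_mulVec Δ (WithLp.toLp 2 fun i => (v i).im)) 2
  rw [mul_pow, EuclideanSpace.norm_sq_eq, EuclideanSpace.norm_sq_eq] at hr hi ⊢
  have key : ∀ i, ‖(toC Δ *ᵥ v.ofLp) i‖ ^ 2
      = ((Δ *ᵥ fun i => (v i).re) i) ^ 2 + ((Δ *ᵥ fun i => (v i).im) i) ^ 2 := by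
    intro i
    rw [← Complex.normSq_eq_norm_sq, Complex.normSq_apply]
    simp [Matrix.mulVec, dotProduct, pow_two]
  have hn : ∀ i, ‖v i‖ ^ 2 = (v i).re ^ 2 + (v i).im ^ 2 := by
    intro i
    rw [← Complex.normSq_eq_norm_sq, Complex.normSq_apply]; ring
  simp only [hn, Finset.sum_add_distrib]
  have hl : ∑ i, ‖(((toEuclideanLin ≪≫ₗ LinearMap.toContinuousLinearMap) (toC Δ)) v).ofLp i‖ ^ 2
      = ∑ i, ((Δ *ᵥ fun i => (v i).re) i) ^ 2 + ∑ i, ((Δ *ᵥ fun i => (v i).im) i) ^ 2 := by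
    rw [← Finset.sum_add_distrib]
    exact Finset.sum_congr rfl fun i _ => key i
  rw [hl]
  simp at hr hi
  linarith

end GMM

/-! ### The transfer matrix, the H∞ norm and the stability radii. -/

namespace GMM

variable {d : ℕ} {U : Matrix (Fin d) (Fin d) ℝ} {lam : Fin d → ℝ} {α β ν M : ℝ}

/-- The diagonal entries of the transfer matrix in the coordinates of the modes. -/
noncomputable def modeTransfer (α β ν l : ℝ) (z : ℂ) : ℂ :=
  ((√l / √2 : ℝ) : ℂ) * (z * (-α / modeChar α β ν l z))

lemma isUnit_sub_AQ (hU : U ∈ Matrix.orthogonalGroup (Fin d) ℝ) (hpos : ∀ i, 0 < lam i)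
    (hM0 : 0 < M)
    (hM : ∀ i, StableWithMargin (modeA α β ν (lam i)) (modeB α β ν (lam i)) (lam i * M))
    {z : ℂ} (hz : 1 ≤ ‖z‖) :
    IsUnit (z • (1 : Matrix (Fin d ⊕ Fin d) (Fin d ⊕ Fin d) ℂ)
      - toC (AQ (U * diagonal lam * Uᵀ) α β ν)) := by
  by_contra hc
  have := two_mul_le_of_mem_spectrum (Δ := 0) hU hpos hM hz (by
    rw [Matrix.mul_zero, Matrix.zero_mul, add_zero, spectrum.mem_iff,
      Algebra.algebraMap_eq_smul_one]
    exact hc)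
  rw [norm_zero] at this
  linarith

lemma transfer_eq (hU : U ∈ Matrix.orthogonalGroup (Fin d) ℝ) (hpos : ∀ i, 0 < lam i)
    (hM0 : 0 < M)
    (hM : ∀ i, StableWithMargin (modeA α β ν (lam i)) (modeB α β ν (lam i)) (lam i * M))
    {z : ℂ} (hz : 1 ≤ ‖z‖) :
    transfer (AQ (U * diagonal lam * Uᵀ) α β ν) (Bmat d α) (Tmat U lam) z
      = diagonal (fun i => modeTransfer α β ν (lam i) z) * toC Uᵀ := by
  have hχ : ∀ i, modeChar α β ν (lam i) z ≠ 0 := by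
    intro i h0
    have h1 := (hM i).mul_sq_le_norm_sq hz
    unfold modeChar at h0
    rw [h0, norm_zero] at h1
    have := hpos i
    have : 0 < lam i * M * ‖z‖ ^ 2 := by positivity
    linarith
  -- Matrices diagonal in the eigenbasis form a commutative algebra under D, so the block inversion
  -- reduces to the scalar equation χ y = -α.
  obtain ⟨D, hD⟩ : ∃ D : (Fin d → ℂ) → Matrix (Fin d) (Fin d) ℂ,
      D = fun f => toC U * diagonal f * toC Uᵀ := ⟨_, rfl⟩
  have Dsmul : ∀ (c : ℂ) f, c • D f = D fun i => c * f i := by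
    intro c f
    have : diagonal (fun i => c * f i) = c • diagonal f := by rw [← diagonal_smul]; rfl
    rw [hD]; simp only [this, Matrix.mul_smul, Matrix.smul_mul]
  have Dadd : ∀ f g, D f + D g = D fun i => f i + g i := by
    intro f g
    rw [hD]; simp only [← diagonal_add, Matrix.mul_add, Matrix.add_mul]
  have Dsub : ∀ f g, D f - D g = D fun i => f i - g i := by
    intro f g
    rw [hD]; simp only [← diagonal_sub, Matrix.mul_sub, Matrix.sub_mul]
  have Dneg : ∀ f, -D f = D fun i => -f i := by
    intro f
    rw [hD]; simp only [← diagonal_neg, Matrix.mul_neg, Matrix.neg_mul]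
  have Dmul : ∀ f g, D f * D g = D fun i => f i * g i := by
    intro f g
    rw [hD]
    simp only
    calc toC U * diagonal f * toC Uᵀ * (toC U * diagonal g * toC Uᵀ)
        = toC U * diagonal f * (toC Uᵀ * toC U) * diagonal g * toC Uᵀ := by noncomm_ring
      _ = _ := by
        rw [toC_transpose_mul_self hU, mul_one, mul_assoc (toC U), diagonal_mul_diagonal]
  have Done : (1 : Matrix (Fin d) (Fin d) ℂ) = D fun _ => 1 := by
    rw [hD]
    simp only [diagonal_one, mul_one]
    exact (toC_mul_transpose_self hU).symm
  have hQ : toC (U * diagonal lam * Uᵀ) = D fun i => (lam i : ℂ) := by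
    rw [hD, toC_mul, toC_mul, toC_diagonal]
  obtain ⟨y, hy⟩ : ∃ y : Fin d → ℂ, y = fun i => -α / modeChar α β ν (lam i) z := ⟨_, rfl⟩
  have hX : (z • (1 : Matrix (Fin d ⊕ Fin d) (Fin d ⊕ Fin d) ℂ)
      - toC (AQ (U * diagonal lam * Uᵀ) α β ν)) * fromRows (z • D y) (D y)
      = toC (Bmat d α) := by
    rw [toC_AQ, toC_Bmat, hQ, ← fromBlocks_one, fromBlocks_smul, sub_eq_add_neg,
      fromBlocks_neg, fromBlocks_add, ← fromRows_fromCols_eq_fromBlocks,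
      fromRows_mul, fromCols_mul_fromRows, fromCols_mul_fromRows]
    congr 1
    · rw [Done]
      simp only [smul_zero, zero_add, Dsmul, Dadd, Dsub, Dneg, Dmul]
      congr 1
      ext i
      have e : modeChar α β ν (lam i) z * y i = -α := by
        rw [hy]; field_simp [hχ i]
      rw [← e]
      simp only [modeChar, modeA, modeB, Complex.ofReal_add, Complex.ofReal_sub,
        Complex.ofReal_mul, Complex.ofReal_one]
      ring
    · simp
  have hinv : (z • (1 : Matrix (Fin d ⊕ Fin d) (Fin d ⊕ Fin d) ℂ)
      - toC (AQ (U * diagonal lam * Uᵀ) α β ν))⁻¹ * toC (Bmat d α)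
      = fromRows (z • D y) (D y) := by
    rw [← hX, Matrix.nonsing_inv_mul_cancel_left]
    exact (Matrix.isUnit_iff_isUnit_det _).1 (isUnit_sub_AQ hU hpos hM0 hM hz)
  unfold transfer
  rw [Matrix.mul_assoc, hinv, toC_Tmat, fromCols_mul_fromRows, Matrix.zero_mul, add_zero, Dsmul, hD]
  simp only
  rw [← mul_assoc, ← mul_assoc, mul_assoc _ (toC Uᵀ) (toC U), toC_transpose_mul_self hU, mul_one,
    diagonal_mul_diagonal, hy]
  rfl

lemma norm_transfer_eq (hU : U ∈ Matrix.orthogonalGroup (Fin d) ℝ) (hpos : ∀ i, 0 < lam i)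
    (hM0 : 0 < M)
    (hM : ∀ i, StableWithMargin (modeA α β ν (lam i)) (modeB α β ν (lam i)) (lam i * M))
    {z : ℂ} (hz : 1 ≤ ‖z‖) :
    ‖transfer (AQ (U * diagonal lam * Uᵀ) α β ν) (Bmat d α) (Tmat U lam) z‖
      = ‖fun i => modeTransfer α β ν (lam i) z‖ := by
  rw [transfer_eq hU hpos hM0 hM hz,
    CStarRing.norm_mul_mem_unitary _ (toC_transpose_mem_unitary hU), Matrix.l2_opNorm_diagonal]

lemma norm_modeTransfer {l : ℝ} {z : ℂ} (hl : 0 < l) (hα : 0 < α) (hz : ‖z‖ = 1) :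
    ‖modeTransfer α β ν l z‖ = √l / √2 * (α / ‖modeChar α β ν l z‖) := by
  unfold modeTransfer
  rw [norm_mul, norm_mul, norm_div, norm_neg, hz, Complex.norm_real, Complex.norm_real,
    Real.norm_of_nonneg (by positivity), Real.norm_of_nonneg hα.le, one_mul]

/-- The output weight √l cancels against |χ| ≥ √(l M), so all modes share one bound, attained by
mode j at z. -/
lemma hInf_eq (hU : U ∈ Matrix.orthogonalGroup (Fin d) ℝ) (hpos : ∀ i, 0 < lam i)
    (hα : 0 < α) (hM0 : 0 < M)
    (hM : ∀ i, StableWithMargin (modeA α β ν (lam i)) (modeB α β ν (lam i)) (lam i * M))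
    {z : ℝ} (hz : z = 1 ∨ z = -1) {j : Fin d}
    (hj : (z ^ 2 - modeA α β ν (lam j) * z + modeB α β ν (lam j)) ^ 2 = lam j * M) :
    hInf (AQ (U * diagonal lam * Uᵀ) α β ν) (Bmat d α) (Tmat U lam)
      = ENNReal.ofReal (α / √(2 * M)) := by
  have hval : ∀ l : ℝ, 0 < l → √l / √2 * (α / √(l * M)) = α / √(2 * M) := by
    intro l hl
    rw [Real.sqrt_mul hl.le, Real.sqrt_mul (by norm_num : (0 : ℝ) ≤ 2)]
    field_simp
  unfold hInf
  refine le_antisymm (iSup₂_le fun w hw => ?_) ?_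
  · rw [← ofReal_norm]
    refine ENNReal.ofReal_le_ofReal ?_
    rw [norm_transfer_eq hU hpos hM0 hM hw.ge, pi_norm_le_iff_of_nonneg (by positivity)]
    intro i
    have hi := hpos i
    rw [norm_modeTransfer hi hα hw, ← hval _ hi]
    have h1 := (hM i).le_norm_sq_of_norm_eq_one hw
    have h2 : √(lam i * M) ≤ ‖modeChar α β ν (lam i) w‖ := Real.sqrt_le_iff.2 ⟨norm_nonneg _, h1⟩
    gcongr
  · have hzn : ‖(z : ℂ)‖ = 1 := by rcases hz with rfl | rfl <;> simp
    refine le_iSup₂_of_le (z : ℂ) hzn ?_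
    rw [← ofReal_norm]
    refine ENNReal.ofReal_le_ofReal ?_
    rw [norm_transfer_eq hU hpos hM0 hM hzn.ge]
    refine le_trans (le_of_eq ?_) (norm_le_pi_norm _ j)
    rw [norm_modeTransfer (hpos j) hα hzn, ← hval _ (hpos j), ← hj, Real.sqrt_sq_eq_abs,
      ← Real.norm_eq_abs, ← Complex.norm_real]
    unfold modeChar
    push_cast
    rfl

/-- Each perturbed eigenvalue lies in the open disc; strictness survives the supremum because the
pairs (eigenvalue, Δ) form a compact set. -/
lemma rhoC_lt_one [Nonempty (Fin d)] (hU : U ∈ Matrix.orthogonalGroup (Fin d) ℝ)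
    (hpos : ∀ i, 0 < lam i) (hα : 0 < α)
    (hM : ∀ i, StableWithMargin (modeA α β ν (lam i)) (modeB α β ν (lam i)) (lam i * M))
    {ε : ℝ≥0} (hε : (ε : ℝ) < √(2 * M) / α) :
    rhoC (AQ (U * diagonal lam * Uᵀ) α β ν) (Bmat d α) (Tmat U lam) ε < 1 := by
  obtain ⟨A, hA⟩ : ∃ A, A = toC (AQ (U * diagonal lam * Uᵀ) α β ν) := ⟨_, rfl⟩
  obtain ⟨B, hB⟩ : ∃ B, B = toC (Bmat d α) := ⟨_, rfl⟩
  obtain ⟨T, hT⟩ : ∃ T, T = toC (Tmat U lam) := ⟨_, rfl⟩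
  have hstab : ∀ (Δ : Matrix (Fin d) (Fin d) ℂ) (z : ℂ), ‖Δ‖ ≤ ε →
      z ∈ spectrum ℂ (A + B * Δ * T) → ‖z‖ < 1 := by
    intro Δ z hΔ hz
    by_contra! hc
    rw [hA, hB, hT] at hz
    have h1 := two_mul_le_of_mem_spectrum hU hpos hM hc hz
    have h2 : √(2 * M) ≤ α * ‖Δ‖ := Real.sqrt_le_iff.2 ⟨by positivity, h1⟩
    rw [lt_div_iff₀ hα] at hε
    have h3 : α * ‖Δ‖ ≤ α * ε := by gcongr
    linarith
  have hspec : ∀ (Δ : Matrix (Fin d) (Fin d) ℂ) (z : ℂ),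
      z ∈ spectrum ℂ (A + B * Δ * T) ↔
        (z • (1 : Matrix (Fin d ⊕ Fin d) (Fin d ⊕ Fin d) ℂ) - (A + B * Δ * T)).det = 0 := by
    intro Δ z
    rw [spectrum.mem_iff, Matrix.isUnit_iff_isUnit_det, isUnit_iff_ne_zero, not_not,
      Algebra.algebraMap_eq_smul_one]
  obtain ⟨K, hK⟩ : ∃ K : Set (ℂ × Matrix (Fin d) (Fin d) ℂ),
      K = {p | ‖p.2‖ ≤ ε ∧ p.1 ∈ spectrum ℂ (A + B * p.2 * T)} := ⟨_, rfl⟩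
  have hclosed : IsClosed K := by
    rw [hK]
    simp only [hspec]
    have h1 : Continuous fun p : ℂ × Matrix (Fin d) (Fin d) ℂ => ‖p.2‖ := continuous_snd.norm
    have h2 : Continuous fun p : ℂ × Matrix (Fin d) (Fin d) ℂ => B * p.2 * T :=
      (continuous_const.matrix_mul continuous_snd).matrix_mul continuous_const
    have h3 : Continuous fun p : ℂ × Matrix (Fin d) (Fin d) ℂ =>
        (p.1 • (1 : Matrix (Fin d ⊕ Fin d) (Fin d ⊕ Fin d) ℂ) - (A + B * p.2 * T)).det :=
      ((continuous_fst.smul continuous_const).sub (continuous_const.add h2)).matrix_det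
    exact (isClosed_le h1 continuous_const).inter (isClosed_eq h3 continuous_const)
  have hsub : K ⊆ Metric.closedBall 0 1 ×ˢ Metric.closedBall 0 ε := by
    rw [hK]
    rintro ⟨z, Δ⟩ ⟨h1, h2⟩
    simp only [Set.mem_prod, mem_closedBall_zero_iff]
    exact ⟨(hstab Δ z h1 h2).le, h1⟩
  have : ProperSpace (Matrix (Fin d) (Fin d) ℂ) := FiniteDimensional.proper ℂ _
  have hcomp : IsCompact K :=
    ((isCompact_closedBall _ _).prod (isCompact_closedBall _ _)).of_isClosed_subset hclosed hsub
  have hne : K.Nonempty := by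
    obtain ⟨z, hz⟩ := spectrum.nonempty (A + B * (0 : Matrix (Fin d) (Fin d) ℂ) * T)
    exact ⟨(z, 0), by rw [hK]; exact ⟨by simp, hz⟩⟩
  obtain ⟨⟨z₀, Δ₀⟩, h₀, hmax⟩ := hcomp.exists_isMaxOn hne
    (f := fun p : ℂ × Matrix (Fin d) (Fin d) ℂ => ‖p.1‖₊) continuous_fst.nnnorm.continuousOn
  have hz₀ : ‖z₀‖ < 1 := by
    rw [hK] at h₀
    exact hstab Δ₀ z₀ h₀.1 h₀.2
  have hle : rhoC (AQ (U * diagonal lam * Uᵀ) α β ν) (Bmat d α) (Tmat U lam) ε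
      ≤ (‖z₀‖₊ : ℝ≥0∞) := by
    refine iSup₂_le fun Δ hΔ => ?_
    rw [← hA, ← hB, ← hT]
    refine iSup₂_le fun z hz => ?_
    have : (z, Δ) ∈ K := by rw [hK]; exact ⟨hΔ, hz⟩
    exact_mod_cast hmax this
  refine hle.trans_lt ?_
  exact_mod_cast hz₀

lemma rhoR_le_rhoC (A : Matrix (Fin d ⊕ Fin d) (Fin d ⊕ Fin d) ℝ)
    (B : Matrix (Fin d ⊕ Fin d) (Fin d) ℝ) (T : Matrix (Fin d) (Fin d ⊕ Fin d) ℝ) (ε : ℝ≥0) :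
    rhoR A B T ε ≤ rhoC A B T ε := by
  refine iSup₂_le fun Δ hΔ => le_iSup₂_of_le (toC Δ) ((norm_toC_le Δ).trans hΔ) (le_of_eq ?_)
  rw [toC_add, toC_mul, toC_mul]

/-- A real multiple of `U` moves an eigenvalue of the critical mode to `z = ±1`. -/
lemma one_le_rhoR (hU : U ∈ Matrix.orthogonalGroup (Fin d) ℝ) (hpos : ∀ i, 0 < lam i)
    (hα : 0 < α) (hM0 : 0 < M) {z : ℝ} (hz : z = 1 ∨ z = -1) {j : Fin d}
    (hj : (z ^ 2 - modeA α β ν (lam j) * z + modeB α β ν (lam j)) ^ 2 = lam j * M)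
    {ε : ℝ≥0} (hε : √(2 * M) / α ≤ ε) :
    1 ≤ rhoR (AQ (U * diagonal lam * Uᵀ) α β ν) (Bmat d α) (Tmat U lam) ε := by
  obtain ⟨χ, hχ⟩ : ∃ χ, χ = z ^ 2 - modeA α β ν (lam j) * z + modeB α β ν (lam j) := ⟨_, rfl⟩
  rw [← hχ] at hj
  have hl := hpos j
  have hzz : z * z = 1 := by rcases hz with rfl | rfl <;> norm_num
  -- Chosen so that feedback through c U cancels χ(z) in mode j; 1 / z = z here.
  obtain ⟨c, hc⟩ : ∃ c, c = -(χ * z) / (α * (√(lam j) / √2)) := ⟨_, rfl⟩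
  have hcabs : |c| = √(2 * M) / α := by
    have h1 : |z| = 1 := by rcases hz with rfl | rfl <;> simp
    have h2 : |χ| = √(lam j) * √M := by
      rw [← Real.sqrt_sq_eq_abs, hj, Real.sqrt_mul hl.le]
    rw [hc, abs_div, abs_neg, abs_mul, h1, h2, abs_of_pos (by positivity),
      Real.sqrt_mul (by norm_num : (0 : ℝ) ≤ 2)]
    field_simp
  have hnorm : ‖c • U‖ ≤ ε := by
    have hn : ‖U‖ ≤ 1 := by
      have hU' : U ∈ unitary (Matrix (Fin d) (Fin d) ℝ) := hU
      have : Nonempty (Fin d) := ⟨j⟩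
      exact (CStarRing.norm_of_mem_unitary hU').le
    rw [norm_smul, Real.norm_eq_abs, hcabs]
    exact (mul_le_of_le_one_right (by positivity) hn).trans hε
  refine le_iSup₂_of_le (c • U) hnorm ?_
  obtain ⟨N, hN⟩ : ∃ N, N = AQ (U * diagonal lam * Uᵀ) α β ν + Bmat d α * (c • U) * Tmat U lam :=
    ⟨_, rfl⟩
  obtain ⟨y, hy⟩ : ∃ y : Fin d → ℝ, y = U *ᵥ Pi.single j 1 := ⟨_, rfl⟩
  have hUy : Uᵀ *ᵥ y = Pi.single j 1 := by
    rw [hy, Matrix.mulVec_mulVec, (Matrix.mem_orthogonalGroup_iff' _ _).1 hU, Matrix.one_mulVec]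
  have hy0 : y ≠ 0 := by
    intro h0
    rw [h0, Matrix.mulVec_zero] at hUy
    have := congrFun hUy j
    simp at this
  have hQy : (U * diagonal lam * Uᵀ) *ᵥ y = lam j • y := by
    have e : Pi.single j (lam j) = lam j • (Pi.single j 1 : Fin d → ℝ) := by
      rw [← Pi.single_smul, smul_eq_mul, mul_one]
    rw [← Matrix.mulVec_mulVec, hUy, ← Matrix.mulVec_mulVec, Matrix.diagonal_mulVec_single,
      mul_one, e, Matrix.mulVec_smul, ← hy]
  have hBy : (c • U) *ᵥ (Tmat U lam *ᵥ Sum.elim (z • y) y) = (c * (√(lam j) / √2) * z) • y := by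
    unfold Tmat
    have e : Pi.single j (√(lam j)) = √(lam j) • (Pi.single j 1 : Fin d → ℝ) := by
      rw [← Pi.single_smul, smul_eq_mul, mul_one]
    rw [Matrix.fromCols_mulVec, Sum.elim_comp_inl, Matrix.zero_mulVec, add_zero]
    simp only [Matrix.smul_mulVec, Matrix.mulVec_smul]
    rw [← Matrix.mulVec_mulVec, hUy, Matrix.diagonal_mulVec_single, mul_one, e,
      Matrix.mulVec_smul, ← hy]
    simp only [smul_smul]
    congr 1
    ring
  have hNv : N *ᵥ Sum.elim (z • y) y = z • Sum.elim (z • y) y := by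
    rw [hN, Matrix.add_mulVec, ← Matrix.mulVec_mulVec, ← Matrix.mulVec_mulVec, hBy]
    unfold AQ Bmat
    rw [Matrix.fromBlocks_mulVec, Matrix.fromRows_mulVec, Sum.elim_comp_inl, Sum.elim_comp_inr]
    simp only [Matrix.add_mulVec, Matrix.sub_mulVec, Matrix.smul_mulVec, Matrix.one_mulVec,
      Matrix.mulVec_smul, hQy, Matrix.zero_mulVec]
    have hk : α * (c * (√(lam j) / √2) * z) = -χ := by
      rw [hc]
      field_simp
      linear_combination -χ * hzz
    ext i
    rcases i with i | i
    · simp only [Pi.add_apply, Pi.sub_apply, Pi.smul_apply, Sum.elim_inl, smul_eq_mul]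
      rw [hχ] at hk
      unfold modeA modeB at hk
      linear_combination (-y i) * hk
    · simp
  have hmem : (z : ℂ) ∈ spectrum ℂ (toC N) := by
    refine mem_spectrum_of_eigenvector (v := fun i => ((Sum.elim (z • y) y i : ℝ) : ℂ)) ?_ ?_
    · intro h0
      apply hy0
      ext i
      simpa using congrFun h0 (Sum.inr i)
    · ext i
      have := congrArg Complex.ofReal (congrFun hNv i)
      rw [Matrix.mulVec, dotProduct] at this
      rw [Matrix.mulVec, dotProduct]
      simpa using this
  rw [← hN]
  refine le_iSup₂_of_le (z : ℂ) hmem ?_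
  have hzn : ‖(z : ℂ)‖₊ = 1 := by rcases hz with rfl | rfl <;> simp
  rw [hzn]; simp

lemma stabRadius_eq (hU : U ∈ Matrix.orthogonalGroup (Fin d) ℝ) (hpos : ∀ i, 0 < lam i)
    (hα : 0 < α) (hM0 : 0 < M)
    (hM : ∀ i, StableWithMargin (modeA α β ν (lam i)) (modeB α β ν (lam i)) (lam i * M))
    {z : ℝ} (hz : z = 1 ∨ z = -1) {j : Fin d}
    (hj : (z ^ 2 - modeA α β ν (lam j) * z + modeB α β ν (lam j)) ^ 2 = lam j * M) :
    stabRadiusR (AQ (U * diagonal lam * Uᵀ) α β ν) (Bmat d α) (Tmat U lam)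
      = ENNReal.ofReal (√(2 * M) / α) ∧
    stabRadiusC (AQ (U * diagonal lam * Uᵀ) α β ν) (Bmat d α) (Tmat U lam)
      = ENNReal.ofReal (√(2 * M) / α) := by
  have : Nonempty (Fin d) := ⟨j⟩
  have hδ : 0 < √(2 * M) / α := by positivity
  have hR : stabRadiusR (AQ (U * diagonal lam * Uᵀ) α β ν) (Bmat d α) (Tmat U lam)
      ≤ ENNReal.ofReal (√(2 * M) / α) :=
    iInf₂_le _ ⟨by simpa using hδ, one_le_rhoR hU hpos hα hM0 hz hj (Real.le_coe_toNNReal _)⟩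
  have hCR : stabRadiusC (AQ (U * diagonal lam * Uᵀ) α β ν) (Bmat d α) (Tmat U lam)
      ≤ stabRadiusR (AQ (U * diagonal lam * Uᵀ) α β ν) (Bmat d α) (Tmat U lam) :=
    le_iInf₂ fun ε hε => iInf₂_le _ ⟨hε.1, hε.2.trans (rhoR_le_rhoC _ _ _ _)⟩
  have hC : ENNReal.ofReal (√(2 * M) / α)
      ≤ stabRadiusC (AQ (U * diagonal lam * Uᵀ) α β ν) (Bmat d α) (Tmat U lam) := by
    refine le_iInf₂ fun ε hε => ?_
    by_contra! hc
    refine absurd hε.2 (not_le.2 (rhoC_lt_one hU hpos hα hM ?_))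
    rw [← ENNReal.ofReal_coe_nnreal, ENNReal.ofReal_lt_ofReal_iff hδ] at hc
    exact hc
  exact ⟨le_antisymm hR (hC.trans hCR), le_antisymm (hCR.trans hR) hC⟩

end GMM

/-! ### The ℓ₂ gain of the noisy iteration. -/

namespace GMM

variable {d : ℕ} {Q U : Matrix (Fin d) (Fin d) ℝ} {lam : Fin d → ℝ} {α β ν M : ℝ}
  {p : EuclideanSpace ℝ (Fin d)} {r : ℝ} {xstar : EuclideanSpace ℝ (Fin d)}

lemma quadObj_add (hQ : Qᵀ = Q) (x v : EuclideanSpace ℝ (Fin d)) :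
    quadObj Q p r (x + v) = quadObj Q p r x + (Q *ᵥ x.ofLp + p.ofLp) ⬝ᵥ v.ofLp
      + 1 / 2 * (v.ofLp ⬝ᵥ Q *ᵥ v.ofLp) := by
  have h : v.ofLp ⬝ᵥ Q *ᵥ x.ofLp = x.ofLp ⬝ᵥ Q *ᵥ v.ofLp := by
    rw [dotProduct_mulVec, ← mulVec_transpose, hQ, dotProduct_comm]
  unfold quadObj
  rw [WithLp.ofLp_add]
  simp only [Matrix.mulVec_add, add_dotProduct, dotProduct_add]
  rw [dotProduct_comm (Q *ᵥ x.ofLp) v.ofLp, h]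
  ring

lemma hasGradientAt_quadObj (hQ : Qᵀ = Q) (x : EuclideanSpace ℝ (Fin d)) :
    HasGradientAt (quadObj Q p r) (WithLp.toLp 2 (Q *ᵥ x.ofLp + p.ofLp)) x := by
  rw [hasGradientAt_iff_isLittleO_nhds_zero]
  have hO : (fun h => quadObj Q p r (x + h) - quadObj Q p r x
      - inner ℝ (WithLp.toLp 2 (Q *ᵥ x.ofLp + p.ofLp)) h) =O[nhds 0]
      fun h : EuclideanSpace ℝ (Fin d) => ‖h‖ ^ 2 := by
    refine Asymptotics.IsBigO.of_bound (1 / 2 * ‖Q‖) (Filter.Eventually.of_forall fun h => ?_)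
    have e0 : ∀ a b c : ℝ, a + b + c - a - b = c := fun a b c => by ring
    have e1 : inner ℝ (WithLp.toLp 2 (Q *ᵥ x.ofLp + p.ofLp)) h
        = (Q *ᵥ x.ofLp + p.ofLp) ⬝ᵥ h.ofLp := by
      rw [EuclideanSpace.inner_eq_star_dotProduct, dotProduct_comm]; simp
    have e2 : h.ofLp ⬝ᵥ Q *ᵥ h.ofLp = inner ℝ (WithLp.toLp 2 (Q *ᵥ h.ofLp)) h := by
      rw [EuclideanSpace.inner_eq_star_dotProduct]; simp
    have e3 : ‖WithLp.toLp 2 (Q *ᵥ h.ofLp)‖ ≤ ‖Q‖ * ‖h‖ := Matrix.l2_opNorm_mulVec Q h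
    rw [quadObj_add hQ, e1, e0, e2, norm_mul, norm_pow, norm_norm,
      Real.norm_of_nonneg (by norm_num : (0 : ℝ) ≤ 1 / 2), mul_assoc]
    have e4 := norm_inner_le_norm (𝕜 := ℝ) (WithLp.toLp 2 (Q *ᵥ h.ofLp)) h
    have e5 := mul_le_mul_of_nonneg_right e3 (norm_nonneg h)
    nlinarith
  exact hO.trans_isLittleO (by
    simpa using (Asymptotics.isLittleO_norm_pow_id one_lt_two))

lemma gradient_quadObj (hQ : Qᵀ = Q) (x : EuclideanSpace ℝ (Fin d)) :
    gradient (quadObj Q p r) x = WithLp.toLp 2 (Q *ᵥ x.ofLp + p.ofLp) :=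
  (hasGradientAt_quadObj hQ x).gradient

lemma mulVec_add_eq_zero_of_min (hQ : Qᵀ = Q)
    (hmin : ∀ x, quadObj Q p r xstar ≤ quadObj Q p r x) : Q *ᵥ xstar.ofLp + p.ofLp = 0 := by
  have h1 : IsLocalMin (quadObj Q p r) xstar := Filter.Eventually.of_forall hmin
  have h2 := h1.hasFDerivAt_eq_zero (hasGradientAt_quadObj hQ xstar).hasFDerivAt
  have h3 := (LinearIsometryEquiv.map_eq_zero_iff _).1 h2
  simpa using congrArg WithLp.ofLp h3

lemma transpose_conj_diagonal : (U * diagonal lam * Uᵀ)ᵀ = U * diagonal lam * Uᵀ := by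
  simp [Matrix.transpose_mul, Matrix.mul_assoc]

/-- Coordinates in the eigenbasis of the objective. -/
def modeCoord (U : Matrix (Fin d) (Fin d) ℝ) (i : Fin d) (v : EuclideanSpace ℝ (Fin d)) : ℝ :=
  (Uᵀ *ᵥ v.ofLp) i

lemma norm_sq_eq_sum_modeCoord (hU : U ∈ Matrix.orthogonalGroup (Fin d) ℝ)
    (v : EuclideanSpace ℝ (Fin d)) : ‖v‖ ^ 2 = ∑ i, modeCoord U i v ^ 2 := by
  have h1 : ∑ i, modeCoord U i v ^ 2 = (Uᵀ *ᵥ v.ofLp) ⬝ᵥ (Uᵀ *ᵥ v.ofLp) := by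
    simp [modeCoord, dotProduct, pow_two]
  have h2 : ‖v‖ ^ 2 = v.ofLp ⬝ᵥ v.ofLp := by
    rw [EuclideanSpace.norm_sq_eq]; simp [dotProduct, pow_two]
  rw [h1, h2, dotProduct_mulVec, ← mulVec_transpose, transpose_transpose, mulVec_mulVec,
    (Matrix.mem_orthogonalGroup_iff _ _).1 hU, one_mulVec]

lemma quadObj_sub_eq_sum (hmin : ∀ x, quadObj (U * diagonal lam * Uᵀ) p r xstar
      ≤ quadObj (U * diagonal lam * Uᵀ) p r x) (x : EuclideanSpace ℝ (Fin d)) :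
    quadObj (U * diagonal lam * Uᵀ) p r x - quadObj (U * diagonal lam * Uᵀ) p r xstar
      = ∑ i, lam i / 2 * modeCoord U i (x - xstar) ^ 2 := by
  have h1 := quadObj_add (Q := U * diagonal lam * Uᵀ) (p := p) (r := r) transpose_conj_diagonal
    xstar (x - xstar)
  rw [mulVec_add_eq_zero_of_min transpose_conj_diagonal hmin, zero_dotProduct, add_zero,
    add_sub_cancel] at h1
  rw [h1, add_sub_cancel_left]
  generalize x - xstar = v
  rw [← mulVec_mulVec, ← mulVec_mulVec, dotProduct_mulVec, ← mulVec_transpose, dotProduct,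
    Finset.mul_sum]
  refine Finset.sum_congr rfl fun i _ => ?_
  rw [mulVec_diagonal]
  unfold modeCoord
  ring

/-- Following the older iterate, the second component of the state, gives a recurrence valid from k
= 0 that starts at x_{-1}, with input w k. -/
lemma modeCoord_state (hU : U ∈ Matrix.orthogonalGroup (Fin d) ℝ)
    (hmin : ∀ x, quadObj (U * diagonal lam * Uᵀ) p r xstar
      ≤ quadObj (U * diagonal lam * Uᵀ) p r x) (w : ℕ → EuclideanSpace ℝ (Fin d))
    (ξ : EuclideanSpace ℝ (Fin d) × EuclideanSpace ℝ (Fin d)) (i : Fin d) (k : ℕ) :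
    modeCoord U i ((state (quadObj (U * diagonal lam * Uᵀ) p r) α β ν w ξ (k + 2)).2 - xstar)
      = modeA α β ν (lam i) * modeCoord U i
          ((state (quadObj (U * diagonal lam * Uᵀ) p r) α β ν w ξ (k + 1)).2 - xstar)
        - modeB α β ν (lam i) * modeCoord U i
          ((state (quadObj (U * diagonal lam * Uᵀ) p r) α β ν w ξ k).2 - xstar)
        + -α * modeCoord U i (w k) := by
  have hp : p.ofLp = -((U * diagonal lam * Uᵀ) *ᵥ xstar.ofLp) :=
    eq_neg_of_add_eq_zero_right (mulVec_add_eq_zero_of_min transpose_conj_diagonal hmin)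
  have hQ : ∀ y, Uᵀ *ᵥ ((U * diagonal lam * Uᵀ) *ᵥ y) = fun i => lam i * (Uᵀ *ᵥ y) i := by
    intro y
    rw [Matrix.mulVec_mulVec, ← mul_assoc, ← mul_assoc,
      (Matrix.mem_orthogonalGroup_iff' _ _).1 hU, one_mul, ← Matrix.mulVec_mulVec]
    ext i; rw [Matrix.mulVec_diagonal]
  simp only [state]
  generalize state (quadObj (U * diagonal lam * Uᵀ) p r) α β ν w ξ k = s
  obtain ⟨x, x'⟩ := s
  rw [gradient_quadObj transpose_conj_diagonal]
  unfold modeCoord modeA modeB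
  simp only [WithLp.ofLp_sub, WithLp.ofLp_add, WithLp.ofLp_smul, Matrix.mulVec_add,
    Matrix.mulVec_sub, Matrix.mulVec_smul, Matrix.mulVec_neg, hp, hQ, Pi.add_apply, Pi.sub_apply,
    Pi.smul_apply, Pi.neg_apply, smul_eq_mul]
  ring

lemma state_congr (f : EuclideanSpace ℝ (Fin d) → ℝ) {w w' : ℕ → EuclideanSpace ℝ (Fin d)}
    (ξ : EuclideanSpace ℝ (Fin d) × EuclideanSpace ℝ (Fin d)) {N : ℕ}
    (h : ∀ k < N, w k = w' k) : ∀ k ≤ N, state f α β ν w ξ k = state f α β ν w' ξ k := by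
  intro k
  induction k with
  | zero => intro _; rfl
  | succ k ih =>
    intro hk
    simp only [state]
    rw [ih (by omega), h k (by omega)]

lemma hasGainLE_of_stableWithMargin (hU : U ∈ Matrix.orthogonalGroup (Fin d) ℝ)
    (hmin : ∀ x, quadObj (U * diagonal lam * Uᵀ) p r xstar
      ≤ quadObj (U * diagonal lam * Uᵀ) p r x) (hα : 0 < α) (hM0 : 0 < M)
    (hM : ∀ i, StableWithMargin (modeA α β ν (lam i)) (modeB α β ν (lam i)) (lam i * M)) :
    HasGainLE (quadObj (U * diagonal lam * Uᵀ) p r) xstar α β ν (α / √(2 * M)).toNNReal := by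
  choose V hV0 hVpos hV using fun i => (hM i).exists_storage
  -- Scaling by 1 / (2M) turns the mode outputs λ M y² into the objective gap λ y² / 2.
  refine ⟨fun ξ => NNReal.mk
    (∑ i, V i (modeCoord U i (ξ.1 - xstar)) (modeCoord U i (ξ.2 - xstar)) / (2 * M))
    (Finset.sum_nonneg fun i _ => div_nonneg (hVpos i _ _) (by positivity)), ?_, fun ξ w hw => ?_⟩
  · ext
    simp [modeCoord, hV0]
  have hws : ∀ i, Summable fun k => modeCoord U i (w k) ^ 2 := fun i =>
    hw.of_nonneg_of_le (fun _ => sq_nonneg _) fun k => by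
      rw [norm_sq_eq_sum_modeCoord hU]
      exact Finset.single_le_sum (f := fun i => modeCoord U i (w k) ^ 2)
        (fun _ _ => sq_nonneg _) (Finset.mem_univ i)
  have hmodes := fun i => hV i
    (fun k => modeCoord U i
      ((state (quadObj (U * diagonal lam * Uᵀ) p r) α β ν w ξ k).2 - xstar))
    (fun k => -α * modeCoord U i (w k)) (modeCoord_state (α := α) (β := β) (ν := ν) hU hmin w ξ i)
    (by simpa only [mul_pow] using (hws i).mul_left ((-α) ^ 2))
  simp only [quadObj_sub_eq_sum hmin]
  have hsum : ∀ i, Summable fun k => lam i / 2 * modeCoord U i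
      ((state (quadObj (U * diagonal lam * Uᵀ) p r) α β ν w ξ k).1 - xstar) ^ 2 :=
    fun i => (hmodes i).1.mul_left _
  refine ⟨summable_sum fun i _ => hsum i, ?_⟩
  rw [Summable.tsum_finsetSum fun i _ => hsum i]
  simp only [norm_sq_eq_sum_modeCoord hU]
  rw [Summable.tsum_finsetSum fun i _ => hws i, NNReal.coe_mk, Real.coe_toNNReal _ (by positivity),
    div_pow, Real.sq_sqrt (by positivity), Finset.mul_sum, ← Finset.sum_add_distrib]
  refine Finset.sum_le_sum fun i _ => ?_
  have h := (hmodes i).2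
  simp only [mul_pow, tsum_mul_left, neg_sq] at h ⊢
  rw [div_mul_eq_mul_div (α ^ 2), ← add_div, le_div_iff₀ (by positivity)]
  calc
    _ = lam i * M * ∑' k, modeCoord U i
      ((state (quadObj (U * diagonal lam * Uᵀ) p r) α β ν w ξ k).1 - xstar) ^ 2 := by ring
    _ ≤ _ := h

lemma le_of_hasGainLE (hU : U ∈ Matrix.orthogonalGroup (Fin d) ℝ) (hpos : ∀ i, 0 < lam i)
    (hmin : ∀ x, quadObj (U * diagonal lam * Uᵀ) p r xstar
      ≤ quadObj (U * diagonal lam * Uᵀ) p r x) (hα : 0 < α) (hM0 : 0 < M)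
    (hM : ∀ i, StableWithMargin (modeA α β ν (lam i)) (modeB α β ν (lam i)) (lam i * M))
    {z : ℝ} (hz : z = 1 ∨ z = -1) {j : Fin d}
    (hj : (z ^ 2 - modeA α β ν (lam j) * z + modeB α β ν (lam j)) ^ 2 = lam j * M)
    {γ : ℝ≥0} (hγ : HasGainLE (quadObj (U * diagonal lam * Uᵀ) p r) xstar α β ν γ) :
    α / √(2 * M) ≤ γ := by
  obtain ⟨H, hH, hgain⟩ := hγ
  obtain ⟨w, hw⟩ : ∃ w : ℕ → EuclideanSpace ℝ (Fin d),
      w = fun k => WithLp.toLp 2 (z ^ k • U *ᵥ Pi.single j 1) := ⟨_, rfl⟩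
  have hcoord : ∀ k, Uᵀ *ᵥ (w k).ofLp = z ^ k • Pi.single j 1 := by
    intro k
    rw [hw]
    simp only [Matrix.mulVec_smul, Matrix.mulVec_mulVec,
      (Matrix.mem_orthogonalGroup_iff' _ _).1 hU, Matrix.one_mulVec]
  have hzk : ∀ k, (z ^ k) ^ 2 = 1 := by
    intro k; rw [← pow_mul, mul_comm, pow_mul]; rcases hz with rfl | rfl <;> simp
  have hwn : ∀ k, ‖w k‖ ^ 2 = 1 := by
    intro k
    rw [norm_sq_eq_sum_modeCoord hU]
    unfold modeCoord
    rw [hcoord]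
    simp [Pi.single_apply, hzk]
  obtain ⟨S, hS⟩ : ∃ S, S = state (quadObj (U * diagonal lam * Uᵀ) p r) α β ν w (xstar, xstar) :=
    ⟨_, rfl⟩
  have hrec := modeCoord_state (α := α) (β := β) (ν := ν) hU hmin w (xstar, xstar) j
  rw [← hS] at hrec
  have hx : ∀ k, -modeCoord U j ((S (k + 2)).2 - xstar) / α
      = modeA α β ν (lam j) * (-modeCoord U j ((S (k + 1)).2 - xstar) / α)
        - modeB α β ν (lam j) * (-modeCoord U j ((S k).2 - xstar) / α) + z ^ k := by
    intro k
    have : modeCoord U j (w k) = z ^ k := by unfold modeCoord; rw [hcoord]; simp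
    rw [hrec, this]; field_simp; ring
  -- Dividing by -α makes the input exactly z^k, so the gap contributed by mode j is C x².
  have key := (hM j).le_of_forall_sum_le (C := lam j * α ^ 2 / 2) (D := (γ : ℝ) ^ 2) hz
    (x := fun k => -modeCoord U j ((S k).2 - xstar) / α) hx fun N => ?_
  · rw [hj] at key
    have h1 : lam j * α ^ 2 ≤ lam j * (γ ^ 2 * (2 * M)) := by linarith
    have h2 : α ^ 2 ≤ γ ^ 2 * (2 * M) := le_of_mul_le_mul_left h1 (hpos j)
    refine le_of_sq_le_sq ?_ γ.2
    rw [div_pow, Real.sq_sqrt (by positivity), div_le_iff₀ (by positivity)]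
    exact h2
  -- The resonant noise is not square-summable; by causality, truncating it leaves the first N
  -- outputs unchanged, and its energy is N.
  · obtain ⟨w', hw'⟩ : ∃ w' : ℕ → EuclideanSpace ℝ (Fin d), w' = fun k => if k < N then w k else 0 :=
      ⟨_, rfl⟩
    have hn : ∀ k, ‖w' k‖ ^ 2 = if k < N then 1 else 0 := by
      intro k; rw [hw']; split_ifs with h <;> simp [h, hwn]
    have hout : ∀ k, k ∉ Finset.range N → ‖w' k‖ ^ 2 = 0 := by
      intro k hk; rw [hn, if_neg (by simpa using hk)]
    have hs' : ∑' k, ‖w' k‖ ^ 2 = N := by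
      rw [tsum_eq_sum hout, Finset.sum_congr rfl fun k hk => by
        rw [hn, if_pos (Finset.mem_range.1 hk)]]
      simp
    obtain ⟨hsum, hle⟩ := hgain (xstar, xstar) w' (summable_of_ne_finset_zero hout)
    rw [hH, hs', NNReal.coe_zero, add_zero] at hle
    refine le_trans ?_ hle
    rw [Finset.mul_sum]
    refine le_trans (Finset.sum_le_sum fun k hk => ?_)
      (hsum.sum_le_tsum (Finset.range N) fun k _ => sub_nonneg.2 (hmin _))
    rw [state_congr _ _ (w' := w) (fun k hk => by rw [hw']; simp [hk]) k (Finset.mem_range.1 hk).le,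
      ← hS, quadObj_sub_eq_sum hmin]
    have e : (S (k + 1)).2 = (S k).1 := by rw [hS]; rfl
    rw [e]
    refine le_trans (le_of_eq ?_) (Finset.single_le_sum
      (f := fun i => lam i / 2 * modeCoord U i ((S k).1 - xstar) ^ 2)
      (fun i _ => mul_nonneg (half_pos (hpos i)).le (sq_nonneg _)) (Finset.mem_univ j))
    field_simp

lemma l2Gain_eq (hU : U ∈ Matrix.orthogonalGroup (Fin d) ℝ) (hpos : ∀ i, 0 < lam i)
    (hmin : ∀ x, quadObj (U * diagonal lam * Uᵀ) p r xstar
      ≤ quadObj (U * diagonal lam * Uᵀ) p r x) (hα : 0 < α) (hM0 : 0 < M)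
    (hM : ∀ i, StableWithMargin (modeA α β ν (lam i)) (modeB α β ν (lam i)) (lam i * M))
    {z : ℝ} (hz : z = 1 ∨ z = -1) {j : Fin d}
    (hj : (z ^ 2 - modeA α β ν (lam j) * z + modeB α β ν (lam j)) ^ 2 = lam j * M) :
    l2Gain (quadObj (U * diagonal lam * Uᵀ) p r) xstar α β ν = ENNReal.ofReal (α / √(2 * M)) := by
  refine le_antisymm (iInf₂_le _ (hasGainLE_of_stableWithMargin hU hmin hα hM0 hM)) ?_
  refine le_iInf₂ fun γ hγ => ?_
  rw [← ENNReal.ofReal_coe_nnreal]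
  exact ENNReal.ofReal_le_ofReal (le_of_hasGainLE hU hpos hmin hα hM0 hM hz hj hγ)

end GMM

/-! ### Assembly: all quantities expressed through α / √(2M). -/

theorem mainTheorem7 {d : ℕ} (μ L : ℝ) (hμ : 0 < μ) (hμL : μ < L)
    (Q U : Matrix (Fin d) (Fin d) ℝ) (lam : Fin d → ℝ)
    (hU : U ∈ Matrix.orthogonalGroup (Fin d) ℝ)
    (hQ : Q = U * Matrix.diagonal lam * U.transpose)
    (hmin : IsLeast (Set.range lam) μ) (hmax : IsGreatest (Set.range lam) L)
    (p : EuclideanSpace ℝ (Fin d)) (r : ℝ)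
    (xstar : EuclideanSpace ℝ (Fin d))
    (hxstar : ∀ x, GMM.quadObj Q p r xstar ≤ GMM.quadObj Q p r x)
    (α β ν : ℝ) (hpar : GMM.IsListed μ L α β ν) :
    spectralRadius ℂ (GMM.toC (GMM.AQ Q α β ν)) < 1 ∧
    0 < GMM.hInf (GMM.AQ Q α β ν) (GMM.Bmat d α) (GMM.Tmat U lam) ∧
    GMM.hInf (GMM.AQ Q α β ν) (GMM.Bmat d α) (GMM.Tmat U lam) < ⊤ ∧
    GMM.stabRadiusR (GMM.AQ Q α β ν) (GMM.Bmat d α) (GMM.Tmat U lam)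
      = GMM.stabRadiusC (GMM.AQ Q α β ν) (GMM.Bmat d α) (GMM.Tmat U lam) ∧
    GMM.stabRadiusC (GMM.AQ Q α β ν) (GMM.Bmat d α) (GMM.Tmat U lam)
      = (GMM.hInf (GMM.AQ Q α β ν) (GMM.Bmat d α) (GMM.Tmat U lam))⁻¹ ∧
    (GMM.hInf (GMM.AQ Q α β ν) (GMM.Bmat d α) (GMM.Tmat U lam))⁻¹
      = (GMM.l2Gain (GMM.quadObj Q p r) xstar α β ν)⁻¹ := by
  obtain ⟨M, hα, hM0, ⟨z, l, hz, hl, hzl⟩, hmargin⟩ := hpar.extremalAtReal hμ hμL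
  obtain ⟨j, rfl⟩ : l ∈ Set.range lam := by
    rcases hl with rfl | rfl
    · exact hmin.1
    · exact hmax.1
  have hlow : ∀ i, μ ≤ lam i := fun i => hmin.2 ⟨i, rfl⟩
  have hpos : ∀ i, 0 < lam i := fun i => hμ.trans_le (hlow i)
  have hM := fun i => hmargin (lam i) (hlow i) (hmax.2 ⟨i, rfl⟩)
  have : Nonempty (Fin d) := ⟨j⟩
  subst hQ
  obtain ⟨hR, hC⟩ := GMM.stabRadius_eq hU hpos hα hM0 hM hz hzl
  have hinv : ENNReal.ofReal (√(2 * M) / α) = (ENNReal.ofReal (α / √(2 * M)))⁻¹ := by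
    rw [← ENNReal.ofReal_inv_of_pos (by positivity), inv_div]
  rw [hR, hC, GMM.hInf_eq hU hpos hα hM0 hM hz hzl,
    GMM.l2Gain_eq hU hpos hxstar hα hM0 hM hz hzl, ENNReal.ofReal_pos]
  refine ⟨?_, by positivity, ENNReal.ofReal_lt_top, rfl, hinv, rfl⟩
  -- Nominal stability is the case of perturbation radius 0.
  refine lt_of_le_of_lt ?_ (GMM.rhoC_lt_one (ε := 0) hU hpos hα hM (by
    rw [NNReal.coe_zero]; positivity))
  refine le_iSup₂_of_le 0 (by simp) (le_of_eq ?_)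
  rw [Matrix.mul_zero, Matrix.zero_mul, add_zero]
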